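/- **Setting.** Let $x'=1-x$ for $x\in[0,1]$. Perform the Cantor construction on $[0,1]$ in which the open middle half of every remaining closed interval is deleted at each stage, and let $M$ be the set of midpoints of the deleted intervals contained in $[3/4,1]$. For $x\in M$ let $I_x$ be the deleted interval with midpoint $x$, and let $r_x$ be its left endpoint. Thompson's group $F$ is the group of orientation-preserving piecewise linear homeomorphisms of $[0,1]$ with finitely many breakpoints, all dyadic, and with slopes integral powers of $2$. For a countable totally ordered set $C$, a group $W_C$ is constructed as follows: choose an order embedding $c\mapsto x_c$ of $C$ into $M$ and, for each $c\in C$, an element $g_c\in F$ with $g_c(r_{x_c}')=r_{x_c}$ which fixes every point of $[0,x_c']\cup[x_c,1]$ and no point of $(x_c',x_c)$; let $W_C$ be generated by all the $g_c$. For a finite set $X\subseteq C$ with elements $c_1<\dots<c_n$, let $G_X=\langle g_{c_1},\dots,g_{c_n}\rangle$. The *slot* of $c_k$ in $X$ is $k$. The *level* in $G_X$ of an element $g\in G_X$ is the largest $k$ such that the sum of the exponents of $g_{c_k}$ in a word in $g_{c_1},\dots,g_{c_n}$ representing $g$ is nonzero (these sums depend on $g$ only). **Statement.** Let $C$ and $D$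 be countable totally ordered sets, and let $W_C$ (with generators $g_c$) and $W_D$ (with generators $h_d$) be any groups constructed as above. Let $X_1\subseteq X_2\subseteq\cdots$ and $Y_1\subseteq Y_2\subseteq\cdots$ be finite sets with $\bigcup_i X_i=C$ and $\bigcup_i Y_i=D$, and let $G_i=\langle g_c: c\in X_i\rangle$ and $H_i=\langle h_d: d\in Y_i\rangle$, with bonding maps the inclusions $\iota_i:G_i\to G_{i+1}$, $j_i:H_i\to H_{i+1}$, $\iota_i':X_i\to X_{i+1}$, $j_i':Y_i\to Y_{i+1}$. Let $P$ be an inj-isomorphism between the direct systems $(G_i)$ and $(H_i)$, that is, a family of homomorphisms $d_i:G_i\to H_i$ and $u_i:H_i\to G_{i+1}$ with $u_i d_i=\iota_i$ and $d_{i+1}u_i=j_i$ for all $i\ge 1$. Then $P$ induces an inj-isomorphism $P'$ between the direct systems of ordered sets $(X_i)$ and $(Y_i)$: there are strictly order-preserving maps $d_i':X_i\to Y_i$ and $u_i':Y_i\to X_{i+1}$ with $u_i' d_i'=\iota_i'$ and $d_{i+1}'u_i'=j_i'$ for all $i\ge 1$, such that for all $i$, all $x\in X_i$ and all $y\in Y_i$,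 the slot of $d_i'(x)$ in $Y_i$ is the level of $d_i(g_x)$ in $H_i$, and the slot of $u_i'(y)$ in $X_{i+1}$ is the level of $u_i(h_y)$ in $G_{i+1}$. -/

import Mathlib

open Topology

namespace LocSolv

/-- The closed unit interval. -/
abbrev I : Type := Set.Icc (0 : ℝ) 1

/-- The group of orientation-preserving homeomorphisms of the unit interval, under composition:
these are exactly the order automorphisms of the interval. -/
abbrev HomeoPlus : Type := I ≃o I

/-- A real number is dyadic. -/
def IsDyadic (t : ℝ) : Prop := ∃ (a : ℤ) (n : ℕ), t = (a : ℝ) / 2 ^ n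

/-- Membership in Thompson's group `F`: away from finitely many dyadic points the homeomorphism
is locally affine, with slope an integral power of two. -/
def InThompsonF (f : HomeoPlus) : Prop :=
  ∃ B : Finset ℝ, (∀ b ∈ B, IsDyadic b) ∧
    ∀ t : I, (t : ℝ) ∉ B →
      ∃ (k : ℤ) (c : ℝ), ∀ᶠ s in 𝓝 t, (f s : ℝ) = (2 : ℝ) ^ k * (s : ℝ) + c

/-- The closed intervals `[a, b]` that occur in the middle-half Cantor construction on `[0, 1]`:
from each of them the open middle half is deleted, and the two outer quarters remain. -/
inductive IsRemaining : ℝ → ℝ → Prop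
  | unit : IsRemaining 0 1
  | left {a b : ℝ} (h : IsRemaining a b) : IsRemaining a (a + (b - a) / 4)
  | right {a b : ℝ} (h : IsRemaining a b) : IsRemaining (b - (b - a) / 4) b

/-- The open interval `(l, r)` is one of the deleted middle halves. -/
def IsDeleted (l r : ℝ) : Prop :=
  ∃ a b : ℝ, IsRemaining a b ∧ l = a + (b - a) / 4 ∧ r = b - (b - a) / 4

/-- The data from which a group `W_C` is built, for an ordered set `C`.  To `c : C` is attached
a deleted interval `(lo c, hi c)` inside `[3/4, 1]`, whose midpoint `x` is the point of the
interval that represents `c`, and an element `gen c` of Thompson's group `F` with the single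
orbital `(1 - x, x)` that sends `1 - lo c` to `lo c`. -/
structure WData (C : Type*) [LinearOrder C] where
  lo : C → ℝ
  hi : C → ℝ
  deleted : ∀ c, IsDeleted (lo c) (hi c)
  confined : ∀ c, 3 / 4 ≤ lo c ∧ hi c ≤ 1
  strictMono_midpoint : StrictMono fun c => (lo c + hi c) / 2
  gen : C → HomeoPlus
  gen_mem : ∀ c, InThompsonF (gen c)
  gen_lo : ∀ (c : C) (t : I), (t : ℝ) = 1 - lo c → (gen c t : ℝ) = lo c
  gen_fixed : ∀ (c : C) (t : I),
    (t : ℝ) ≤ 1 - (lo c + hi c) / 2 ∨ (lo c + hi c) / 2 ≤ (t : ℝ) → gen c t = t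
  gen_moved : ∀ (c : C) (t : I),
    1 - (lo c + hi c) / 2 < (t : ℝ) → (t : ℝ) < (lo c + hi c) / 2 → gen c t ≠ t

/-- The slot of `x` when the finite ordered set `X` is listed increasingly, counting from `1`. -/
def slot {C : Type*} [LinearOrder C] (X : Finset C) (x : X) : ℕ :=
  (X.filter fun y => y ≤ (x : C)).card

/-- The algebraic sum of a word with respect to a generator: the sum of the exponents of all
appearances of the letter `x` in `w`. -/
def expSum {α : Type*} [DecidableEq α] (x : α) (w : FreeGroup α) : ℤ :=
  Multiplicative.toAdd
    (FreeGroup.lift (fun y => Multiplicative.ofAdd (if y = x then (1 : ℤ) else 0)) w)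

/-- The level of a word in generators indexed by the finite ordered set `X`: the largest slot of
a letter with nonzero algebraic sum (and `0` if there is none). -/
def wordLevel {C : Type*} [LinearOrder C] (X : Finset C) (w : FreeGroup X) : ℕ :=
  (Finset.univ.filter fun x : X => expSum x w ≠ 0).sup (slot X)

namespace WData

variable {C : Type*} [LinearOrder C] (W : WData C)

/-- The subgroup generated by the generators attached to a finite subset of `C`. -/
def group (X : Finset C) : Subgroup HomeoPlus :=
  Subgroup.closure (W.gen '' (X : Set C))

theorem group_mono {X Y : Finset C} (h : X ⊆ Y) : W.group X ≤ W.group Y :=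
  Subgroup.closure_mono (Set.image_mono (Finset.coe_subset.mpr h))

/-- A generator, as an element of the group it helps to generate. -/
def genIn (X : Finset C) (x : X) : W.group X :=
  ⟨W.gen x, Subgroup.subset_closure ⟨x, x.2, rfl⟩⟩

/-- The element of the group represented by a word in the generators. -/
def eval (X : Finset C) : FreeGroup X →* W.group X :=
  FreeGroup.lift (W.genIn X)

/-- The element `g` of the group generated by `X` has level `k`: the words in the generators
that represent `g` have level `k`.  (Algebraic sums depend on the element only, and every `g`
is represented by some word, so each element has exactly one level.) -/
def HasLevel (X : Finset C) (g : W.group X) (k : ℕ) : Prop :=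
  ∀ w : FreeGroup X, W.eval X w = g → wordLevel X w = k

end WData

/-- An increasing sequence of finite subsets with union `C`: the direct system of finite
ordered sets (and inclusions) with direct limit `C`. -/
structure Exhaustion (C : Type*) where
  set : ℕ → Finset C
  mono : ∀ i, set i ⊆ set (i + 1)
  exhausts : ∀ c, ∃ i, c ∈ set i

/-- An inj-isomorphism between the direct systems of groups generated by the sets of `X` and of
`Y`: homomorphisms down and up that make all triangles with the bonding inclusions commute. -/
structure GroupInjIso {C D : Type*} [LinearOrder C] [LinearOrder D]
    (V : WData C) (W : WData D) (X : Exhaustion C) (Y : Exhaustion D) where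
  d : ∀ i, V.group (X.set i) →* W.group (Y.set i)
  u : ∀ i, W.group (Y.set i) →* V.group (X.set (i + 1))
  u_d : ∀ i (g : V.group (X.set i)),
    u i (d i g) = Subgroup.inclusion (V.group_mono (X.mono i)) g
  d_u : ∀ i (h : W.group (Y.set i)),
    d (i + 1) (u i h) = Subgroup.inclusion (W.group_mono (Y.mono i)) h

/-- An inj-isomorphism between direct systems of finite ordered sets: order embeddings down and
up that make all triangles with the bonding inclusions commute. -/
structure SetInjIso {C D : Type*} [LinearOrder C] [LinearOrder D]
    (X : Exhaustion C) (Y : Exhaustion D) where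
  d : ∀ i, X.set i ↪o Y.set i
  u : ∀ i, Y.set i ↪o X.set (i + 1)
  u_d : ∀ i (x : X.set i), u i (d i x) = ⟨x, X.mono i x.2⟩
  d_u : ∀ i (y : Y.set i), d (i + 1) (u i y) = ⟨y, Y.mono i y.2⟩

end LocSolv

/-! The group `G_X` is an iterated restricted wreath product of infinite cyclic groups, one factor
for each element of `X`. It is modelled by `Gr X`, acting on integer sequences: `tau c` adds 1 at
place `c` to the sequences that vanish above `c`. A node of depth `k` is a class of sequences that
agree above `k`; nodes are nested or disjoint, the group permutes them, and an element shifts only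
finitely many nodes of each depth. The identification (`exists_mulEquiv`) holds because `[1 - lo d,
lo d)` is a fundamental domain of `g_d` that contains the supports of all smaller generators.

The group theory rests on one finiteness argument (`eq_self_of_commute`): an element that commutes
with an element shifting a node, and does not shift that node itself, is trivial on it. Let `ψ` be
injective, `ψ a = tau x`, `ψ b = tau y` and `x < y`. Translating commutation back and forth through
`ψ` shows (`exists_depth_lt`) that `b` shifts exactly one node of its top depth, and that this depth
exceeds every depth at which `a` acts. With a single shifted node nothing can cancel, so the
exponent sum of `b` at its top depth is nonzero, while that of `a` vanishes from there on. Applied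
to the maps of an inj-isomorphism, all of which are injective, this says that the levels of the
images of generators increase strictly.

Exponent sums are homomorphisms to the integers. Strict monotonicity makes their matrices
triangular, so levels are compatible with composition (`IsLevel.map`), and the triangles of group
homomorphisms become triangles of order embeddings. -/

namespace LocSolv

/-! ### The iterated wreath product acting on integer sequences -/

namespace Wreath

variable {ι : Type*} [LinearOrder ι]

/-- Two integer sequences lie in the same node of depth `k`: they agree at all places above `k`. -/
def Agree (k : ι) (ω ω' : ι → ℤ) : Prop := ∀ j, k < j → ω j = ω' j

theorem Agree.refl (k : ι) (ω : ι → ℤ) : Agree k ω ω := fun _ _ => rfl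

theorem Agree.symm {k : ι} {ω ω' : ι → ℤ} (h : Agree k ω ω') : Agree k ω' ω :=
  fun j hj => (h j hj).symm

theorem Agree.trans {k : ι} {ω ω' ω'' : ι → ℤ} (h : Agree k ω ω') (h' : Agree k ω' ω'') :
    Agree k ω ω'' := fun j hj => (h j hj).trans (h' j hj)

theorem Agree.mono {k l : ι} {ω ω' : ι → ℤ} (h : Agree k ω ω') (hkl : k ≤ l) : Agree l ω ω' :=
  fun j hj => h j (hkl.trans_lt hj)

open Classical in
/-- Add `n` to the coordinate at `c` of the sequences that vanish above `c`. -/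
noncomputable def tauFun (c : ι) (n : ℤ) (ω : ι → ℤ) : ι → ℤ :=
  if Agree c ω 0 then ω + Pi.single c n else ω

theorem tauFun_of_agree {c : ι} {ω : ι → ℤ} (h : Agree c ω 0) (n : ℤ) :
    tauFun c n ω = ω + Pi.single c n := if_pos h

theorem tauFun_of_not_agree {c : ι} {ω : ι → ℤ} (h : ¬ Agree c ω 0) (n : ℤ) :
    tauFun c n ω = ω := if_neg h

theorem agree_add_single (c : ι) (n : ℤ) (ω : ι → ℤ) : Agree c (ω + Pi.single c n) ω := by
  intro j hj
  simp [hj.ne']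

theorem tauFun_tauFun (c : ι) (m n : ℤ) (ω : ι → ℤ) :
    tauFun c m (tauFun c n ω) = tauFun c (m + n) ω := by
  by_cases h : Agree c ω 0
  · rw [tauFun_of_agree h, tauFun_of_agree ((agree_add_single c n ω).trans h), tauFun_of_agree h,
      add_assoc, ← Pi.single_add, add_comm n]
  · simp [tauFun_of_not_agree h]

theorem tauFun_zero (c : ι) (ω : ι → ℤ) : tauFun c 0 ω = ω := by
  by_cases h : Agree c ω 0
  · simp [tauFun_of_agree h]
  · simp [tauFun_of_not_agree h]

/-- The standard generator of the iterated wreath product. -/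
noncomputable def tau (c : ι) : Equiv.Perm (ι → ℤ) where
  toFun := tauFun c 1
  invFun := tauFun c (-1)
  left_inv ω := by rw [tauFun_tauFun]; exact tauFun_zero c ω
  right_inv ω := by rw [tauFun_tauFun]; exact tauFun_zero c ω

theorem tau_apply (c : ι) (ω : ι → ℤ) : tau c ω = tauFun c 1 ω := rfl

theorem tau_inv_apply (c : ι) (ω : ι → ℤ) : (tau c)⁻¹ ω = tauFun c (-1) ω := rfl

theorem tau_zpow_apply (c : ι) (n : ℤ) (ω : ι → ℤ) : (tau c ^ n) ω = tauFun c n ω := by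
  induction n using Int.induction_on generalizing ω with
  | zero => simp [tauFun_zero]
  | succ n ih => rw [zpow_add_one, Equiv.Perm.mul_apply, ih, tau_apply, tauFun_tauFun]
  | pred n ih => rw [zpow_sub_one, Equiv.Perm.mul_apply, ih, tau_inv_apply, tauFun_tauFun,
      sub_eq_add_neg]

variable (ι) in
/-- The iterated restricted wreath product of infinite cyclic groups indexed by `ι`, as a group
of permutations of the integer sequences. -/
noncomputable def Gr : Subgroup (Equiv.Perm (ι → ℤ)) := Subgroup.closure (Set.range tau)

theorem tau_mem (c : ι) : tau c ∈ Gr ι := Subgroup.subset_closure ⟨c, rfl⟩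

theorem inv_apply_self' {α : Type*} (a : Equiv.Perm α) (x : α) : a⁻¹ (a x) = x :=
  a.symm_apply_apply x

theorem apply_inv_self' {α : Type*} (a : Equiv.Perm α) (x : α) : a (a⁻¹ x) = x :=
  a.apply_symm_apply x

theorem Gr_induction {p : Equiv.Perm (ι → ℤ) → Prop} (one : p 1)
    (gen : ∀ (c : ι) (n : ℤ), p (tau c ^ n))
    (mul : ∀ a b, a ∈ Gr ι → b ∈ Gr ι → p a → p b → p (a * b)) {a : Equiv.Perm (ι → ℤ)}
    (ha : a ∈ Gr ι) : p a := by
  induction ha using Subgroup.closure_induction'' with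
  | mem a ha =>
    obtain ⟨c, rfl⟩ := ha
    simpa using gen c 1
  | inv_mem a ha =>
    obtain ⟨c, rfl⟩ := ha
    simpa using gen c (-1)
  | one => exact one
  | mul a b ha hb iha ihb => exact mul a b ha hb iha ihb

theorem tauFun_apply_of_ne {c k : ι} (hk : k ≠ c) (n : ℤ) (ω : ι → ℤ) :
    tauFun c n ω k = ω k := by
  by_cases h0 : Agree c ω 0
  · rw [tauFun_of_agree h0]; simp [hk]
  · rw [tauFun_of_not_agree h0]

theorem agree_of_forall_shift {a : Equiv.Perm (ι → ℤ)}
    (h : ∀ {k : ι} {ω ω' : ι → ℤ}, Agree k ω ω' → a ω k - ω k = a ω' k - ω' k)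
    {k : ι} {ω ω' : ι → ℤ} (hω : Agree k ω ω') : Agree k (a ω) (a ω') := by
  intro j hj
  have := h (hω.mono hj.le)
  have := hω j hj
  omega

/-- The change of the coordinate at `k` depends on the node of depth `k` only. -/
theorem shift_congr {a : Equiv.Perm (ι → ℤ)} (ha : a ∈ Gr ι) :
    ∀ {k : ι} {ω ω' : ι → ℤ}, Agree k ω ω' → a ω k - ω k = a ω' k - ω' k := by
  refine Gr_induction (p := fun a => ∀ {k : ι} {ω ω' : ι → ℤ}, Agree k ω ω' →
    a ω k - ω k = a ω' k - ω' k) ?_ ?_ ?_ ha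
  · simp
  · intro c n k ω ω' h
    simp only [tau_zpow_apply]
    rcases eq_or_ne k c with rfl | hk
    · by_cases h0 : Agree k ω 0
      · rw [tauFun_of_agree h0, tauFun_of_agree (h.symm.trans h0)]; simp
      · rw [tauFun_of_not_agree h0, tauFun_of_not_agree (fun h1 => h0 (h.trans h1))]; simp
    · simp [tauFun_apply_of_ne hk]
  · intro a b _ _ iha ihb k ω ω' h
    have h1 := iha (agree_of_forall_shift ihb h)
    have h2 := ihb h
    simp only [Equiv.Perm.mul_apply]
    omega

theorem Agree.map {a : Equiv.Perm (ι → ℤ)} (ha : a ∈ Gr ι) {k : ι} {ω ω' : ι → ℤ}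
    (h : Agree k ω ω') : Agree k (a ω) (a ω') := agree_of_forall_shift (shift_congr ha) h

theorem agree_map_iff {a : Equiv.Perm (ι → ℤ)} (ha : a ∈ Gr ι) {k : ι} {ω ω' : ι → ℤ} :
    Agree k (a ω) (a ω') ↔ Agree k ω ω' :=
  ⟨fun h => by simpa using h.map (inv_mem ha), fun h => h.map ha⟩

theorem Agree.fixes {a : Equiv.Perm (ι → ℤ)} (ha : a ∈ Gr ι) {k : ι} {ω ω' : ι → ℤ}
    (h : Agree k (a ω) ω) (h' : Agree k ω' ω) : Agree k (a ω') ω' :=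
  (h'.map ha).trans (h.trans h'.symm)

open Classical in
/-- The canonical representative of a node of depth `k`. -/
noncomputable def trunc (k : ι) (ω : ι → ℤ) : ι → ℤ := fun j => if k < j then ω j else 0

theorem agree_trunc (k : ι) (ω : ι → ℤ) : Agree k (trunc k ω) ω := fun j hj => by simp [trunc, hj]

theorem trunc_congr {k : ι} {ω ω' : ι → ℤ} (h : Agree k ω ω') : trunc k ω = trunc k ω' := by
  funext j
  by_cases hj : k < j
  · simp [trunc, hj, h j hj]
  · simp [trunc, hj]

/-- This is where the wreath product is restricted: a generator shifts at most one node, and a node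
shifted by `a * b` is either shifted by `b` or carried by `b` to a node shifted by `a`. -/
theorem finite_trunc {a : Equiv.Perm (ι → ℤ)} (ha : a ∈ Gr ι) (k : ι) :
    {ρ | ∃ ω, trunc k ω = ρ ∧ a ω k ≠ ω k}.Finite := by
  refine Gr_induction (p := fun a => {ρ | ∃ ω, trunc k ω = ρ ∧ a ω k ≠ ω k}.Finite)
    ?_ ?_ ?_ ha
  · simp
  · intro c n
    refine (Set.finite_singleton (0 : ι → ℤ)).subset ?_
    rintro ρ ⟨ω, rfl, h⟩
    rw [tau_zpow_apply] at h
    rcases eq_or_ne k c with rfl | hk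
    · by_cases h0 : Agree k ω 0
      · rw [trunc_congr h0]
        simp only [Set.mem_singleton_iff]
        funext j
        simp [trunc]
      · exact absurd (by rw [tauFun_of_not_agree h0]) h
    · exact absurd (tauFun_apply_of_ne hk n ω) h
  · intro a b ha hb fa fb
    refine (fb.union (fa.image fun ρ => trunc k (b⁻¹ ρ))).subset ?_
    rintro ρ ⟨ω, rfl, h⟩
    by_cases h1 : b ω k = ω k
    · refine Or.inr ⟨trunc k (b ω), ⟨b ω, rfl, ?_⟩, ?_⟩
      · rwa [h1]
      · refine trunc_congr ?_
        simpa using (agree_trunc k (b ω)).map (inv_mem hb)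
    · exact Or.inl ⟨ω, rfl, h1⟩

/-- Only finitely many values occur at `k` among the sequences that are changed below `k`. -/
theorem finite_coord {a : Equiv.Perm (ι → ℤ)} (ha : a ∈ Gr ι) {j k : ι} (hjk : j < k) :
    {n | ∃ ω : ι → ℤ, ω k = n ∧ a ω j ≠ ω j}.Finite := by
  refine ((finite_trunc ha j).image fun ρ => ρ k).subset ?_
  rintro n ⟨ω, rfl, h⟩
  exact ⟨trunc j ω, ⟨ω, rfl, h⟩, agree_trunc j ω k hjk⟩

/-! ### Transitivity, and restriction of elements to nodes -/

theorem exists_top_change [Finite ι] {ω ω' : ι → ℤ} (h : ω ≠ ω') :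
    ∃ k, ω k ≠ ω' k ∧ Agree k ω ω' := by
  have hne : {k | ω k ≠ ω' k}.Nonempty := by
    by_contra hc
    rw [Set.not_nonempty_iff_eq_empty] at hc
    exact h (funext fun k => by_contra fun hk => (hc ▸ hk : k ∈ (∅ : Set ι)))
  obtain ⟨k, hk⟩ := (Set.toFinite {k | ω k ≠ ω' k}).exists_maximal hne
  refine ⟨k, hk.prop, fun j hj => ?_⟩
  by_contra hc
  exact absurd (hk.le_of_ge hc hj.le) (not_le.mpr hj)

/-- Coordinates are cleared from the largest place down: once everything above `m` vanishes, a power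
of `tau m` clears place `m` and changes nothing else. -/
theorem exists_map_eq_zero [Finite ι] (ω : ι → ℤ) : ∃ a ∈ Gr ι, a ω = 0 := by
  have := Fintype.ofFinite ι
  have key : ∀ (s : Finset ι) (ω : ι → ℤ), (∀ j ∉ s, ω j = 0) → ∃ a ∈ Gr ι, a ω = 0 := by
    intro s
    induction s using Finset.induction_on_max with
    | empty => exact fun ω h => ⟨1, one_mem _, funext fun j => h j (by simp)⟩
    | insert m s hs ih =>
      intro ω h
      have hm : Agree m ω 0 := fun j hj => h j (by
        simp only [Finset.mem_insert, not_or]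
        exact ⟨hj.ne', fun hjs => (hs j hjs).not_gt hj⟩)
      obtain ⟨a, ha, h0⟩ := ih (tauFun m (-ω m) ω) (fun j hj => by
        rw [tauFun_of_agree hm]
        by_cases hjm : j = m
        · subst hjm; simp
        · simp [hjm, h j (by simp [hj, hjm])])
      exact ⟨a * tau m ^ (-ω m), mul_mem ha (zpow_mem (tau_mem m) _), by
        rw [Equiv.Perm.mul_apply, tau_zpow_apply, h0]⟩
  exact key Finset.univ ω (by simp)

theorem exists_map_eq [Finite ι] (ω ω' : ι → ℤ) : ∃ a ∈ Gr ι, a ω = ω' := by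
  obtain ⟨a, ha, h⟩ := exists_map_eq_zero ω
  obtain ⟨b, hb, h'⟩ := exists_map_eq_zero ω'
  exact ⟨b⁻¹ * a, mul_mem (inv_mem hb) ha, by
    rw [Equiv.Perm.mul_apply, h, ← h', inv_apply_self']⟩

open Classical in
/-- The sequence with the low coordinates of the first and the high ones of the second. -/
noncomputable def merge (k : ι) (ω ω' : ι → ℤ) : ι → ℤ := fun j => if k < j then ω' j else ω j

theorem agree_merge (k : ι) (ω ω' : ι → ℤ) : Agree k (merge k ω ω') ω' := fun j hj => by
  simp [merge, hj]

theorem merge_eq_self {k : ι} {ω ω' : ι → ℤ} (h : Agree k ω ω') : merge k ω ω' = ω := by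
  funext j
  by_cases hj : k < j
  · simp [merge, hj, h j hj]
  · simp [merge, hj]

theorem merge_merge (k : ι) (ω ω' ω'' : ι → ℤ) :
    merge k (merge k ω ω') ω'' = merge k ω ω'' := by
  funext j
  by_cases hj : k < j <;> simp [merge, hj]

theorem merge_congr {k : ι} {ω' ω'' : ι → ℤ} (ω : ι → ℤ) (h : Agree k ω' ω'') :
    merge k ω ω' = merge k ω ω'' := by
  funext j
  by_cases hj : k < j
  · simp [merge, hj, h j hj]
  · simp [merge, hj]

/-- The action of an element on a node, transported to the node of the zero sequence, is the
action of an element. -/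
theorem exists_section {a : Equiv.Perm (ι → ℤ)} (ha : a ∈ Gr ι) (k : ι) :
    ∀ ρ : ι → ℤ, ∃ c ∈ Gr ι, (∀ ω, Agree k ω 0 → c ω = merge k (a (merge k ω ρ)) 0) ∧
      ∀ ω, ¬ Agree k ω 0 → c ω = ω := by
  refine Gr_induction (p := fun a => ∀ ρ : ι → ℤ, ∃ c ∈ Gr ι,
    (∀ ω, Agree k ω 0 → c ω = merge k (a (merge k ω ρ)) 0) ∧
      ∀ ω, ¬ Agree k ω 0 → c ω = ω) ?_ ?_ ?_ ha
  · refine fun ρ => ⟨1, one_mem _, fun ω h => ?_, fun ω _ => rfl⟩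
    simp [merge_merge, merge_eq_self h]
  · intro c n ρ
    -- A power of `tau c` acts inside the node of `ρ` only if `c ≤ k` and this is the zero node.
    -- Otherwise it is trivial there, or, for `k < c`, it preserves the coordinates up to `k`; the
    -- transported action is then the identity.
    by_cases hc : c ≤ k ∧ Agree k ρ 0
    · refine ⟨tau c ^ n, zpow_mem (tau_mem c) n, fun ω h => ?_, fun ω h => ?_⟩
      · rw [merge_congr ω hc.2, merge_eq_self h, merge_eq_self]
        intro j hj
        rw [tau_zpow_apply, tauFun_apply_of_ne (hc.1.trans_lt hj).ne', h j hj]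
      · rw [tau_zpow_apply, tauFun_of_not_agree (fun h' => h (h'.mono hc.1))]
    · refine ⟨1, one_mem _, fun ω h => ?_, fun ω _ => rfl⟩
      rw [tau_zpow_apply]
      by_cases hck : c ≤ k
      · have hρ : ¬ Agree k ρ 0 := fun h => hc ⟨hck, h⟩
        rw [tauFun_of_not_agree, merge_merge, merge_eq_self h, Equiv.Perm.one_apply]
        exact fun h' => hρ ((agree_merge k ω ρ).symm.trans (h'.mono hck))
      · rw [not_le] at hck
        have h1 : merge k ω 0 = ω := merge_eq_self h
        rw [Equiv.Perm.one_apply]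
        funext j
        by_cases hj : k < j
        · simp [merge, hj, h j hj]
        · have hjc : j ≠ c := fun h => hj (h ▸ hck)
          simp [merge, hj, tauFun_apply_of_ne hjc]
  · intro a b ha hb iha ihb ρ
    obtain ⟨d, hd, hd1, hd2⟩ := ihb ρ
    -- Cocycle rule: the section of `a * b` at `ρ` is the section of `a` at `b ρ` times that of `b`
    -- at `ρ`.
    obtain ⟨c, hc, hc1, hc2⟩ := iha (b ρ)
    refine ⟨c * d, mul_mem hc hd, fun ω h => ?_, fun ω h => ?_⟩
    · rw [Equiv.Perm.mul_apply, hd1 ω h, hc1 _ (agree_merge _ _ _), merge_merge,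
        merge_eq_self (ω' := b ρ), Equiv.Perm.mul_apply]
      exact (agree_merge k ω ρ).map hb
    · rw [Equiv.Perm.mul_apply, hd2 ω h, hc2 ω h]

/-- `c` is the restriction of `a` to the node of `ρ` of depth `k`. -/
structure IsRestr (k : ι) (ρ : ι → ℤ) (a c : Equiv.Perm (ι → ℤ)) : Prop where
  on : ∀ ω, Agree k ω ρ → c ω = a ω
  off : ∀ ω, ¬ Agree k ω ρ → c ω = ω

/-- By transitivity the node can be moved to the zero node, where the section from `exists_section`
is the restriction; conjugating back finishes. -/
theorem exists_isRestr [Finite ι] {a : Equiv.Perm (ι → ℤ)} (ha : a ∈ Gr ι) {k : ι}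
    {ρ : ι → ℤ} (hρ : Agree k (a ρ) ρ) : ∃ c ∈ Gr ι, IsRestr k ρ a c := by
  obtain ⟨e, he, h0⟩ := exists_map_eq_zero ρ
  have hm : e * a * e⁻¹ ∈ Gr ι := mul_mem (mul_mem he ha) (inv_mem he)
  have hA : ∀ ω, Agree k (e ω) 0 ↔ Agree k ω ρ := fun ω => by
    rw [← h0, agree_map_iff he]
  obtain ⟨c, hc, h1, h2⟩ := exists_section hm k 0
  refine ⟨e⁻¹ * c * e, mul_mem (mul_mem (inv_mem he) hc) he, fun ω h => ?_, fun ω h => ?_⟩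
  · have h3 := (hA ω).mpr h
    simp only [Equiv.Perm.mul_apply]
    rw [h1 _ h3, merge_eq_self h3]
    rw [Equiv.Perm.mul_apply, Equiv.Perm.mul_apply, inv_apply_self',
      merge_eq_self ((hA _).mpr ((h.map ha).trans hρ)), inv_apply_self']
  · simp only [Equiv.Perm.mul_apply]
    rw [h2 _ (fun h' => h ((hA ω).mp h')), inv_apply_self']

/-! ### Commuting with an element that shifts a node -/

theorem finite_coord_of_fixes [Finite ι] {e : Equiv.Perm (ι → ℤ)} (he : e ∈ Gr ι) {k : ι}
    {ρ : ι → ℤ} (heρ : Agree k (e ρ) ρ) (hek : e ρ k = ρ k) :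
    {n | ∃ ω : ι → ℤ, Agree k ω ρ ∧ ω k = n ∧ e ω ≠ ω}.Finite := by
  have hfin : (⋃ i ∈ {i | i < k}, {n | ∃ ω : ι → ℤ, ω k = n ∧ e ω i ≠ ω i}).Finite :=
    (Set.toFinite _).biUnion fun i hi => finite_coord he hi
  refine hfin.subset ?_
  rintro n ⟨ω, hω, rfl, hne⟩
  obtain ⟨i, hi, -⟩ := exists_top_change hne
  refine Set.mem_biUnion (x := i) ?_ ⟨_, rfl, hi⟩
  by_contra hc
  rcases (not_lt.mp hc).eq_or_lt with rfl | hlt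
  · have := shift_congr he hω
    omega
  · exact hi ((Agree.fixes he heρ hω) i hlt)

/-- An element that commutes on a node with an element shifting the node, and does not shift
the node itself, is trivial on the node. -/
theorem eq_self_of_comm [Finite ι] {e v : Equiv.Perm (ι → ℤ)} (he : e ∈ Gr ι) (hv : v ∈ Gr ι)
    {k : ι} {ρ : ι → ℤ} (hvρ : Agree k (v ρ) ρ) (hvk : v ρ k ≠ ρ k) (heρ : Agree k (e ρ) ρ)
    (hek : e ρ k = ρ k) (hcomm : ∀ ω, Agree k ω ρ → e (v ω) = v (e ω)) {ω : ι → ℤ}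
    (hω : Agree k ω ρ) : e ω = ω := by
  by_contra hne
  -- If `e` moved `ω`, it would move every `v ^ n` translate of it; these have infinitely many
  -- values at `k`, against `finite_coord_of_fixes`.
  have hpow : ∀ n : ℕ, Agree k ((v ^ n) ω) ρ ∧
      (v ^ n) ω k = ω k + n * (v ρ k - ρ k) ∧ e ((v ^ n) ω) ≠ (v ^ n) ω := by
    intro n
    induction n with
    | zero => simpa using ⟨hω, hne⟩
    | succ n ih =>
      rw [pow_succ', Equiv.Perm.mul_apply]
      refine ⟨(ih.1.map hv).trans hvρ, ?_, fun h => ih.2.2 (v.injective ?_)⟩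
      · have h1 := shift_congr hv ih.1
        have h2 := ih.2.1
        push_cast
        linear_combination h1 + h2
      · rw [← hcomm _ ih.1, h]
  refine Set.infinite_of_injective_forall_mem (f := fun n : ℕ => (v ^ n) ω k) ?_ ?_
    (finite_coord_of_fixes he heρ hek)
  · intro m n hmn
    simp only [(hpow _).2.1] at hmn
    have : (m : ℤ) * (v ρ k - ρ k) = n * (v ρ k - ρ k) := by linarith
    exact_mod_cast mul_right_cancel₀ (sub_ne_zero.mpr hvk) this
  · exact fun n => ⟨_, (hpow n).1, rfl, (hpow n).2.2⟩

/-- An element fixes the nodes that are shifted by an element commuting with it. -/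
theorem fixes_of_comm [Finite ι] {e v : Equiv.Perm (ι → ℤ)} (he : e ∈ Gr ι) (hv : v ∈ Gr ι)
    {k : ι} {ρ : ι → ℤ} (hvρ : Agree k (v ρ) ρ) (hvk : v ρ k ≠ ρ k) (hcomm : e * v = v * e) :
    Agree k (e ρ) ρ := by
  by_contra hne
  obtain ⟨j, hj, hjA⟩ := exists_top_change (ω := e ρ) (ω' := ρ) (by
    rintro h
    exact hne (by rw [h]; exact Agree.refl _ _))
  have hkj : k < j := by
    by_contra hc
    exact hne (hjA.mono (not_lt.mp hc))
  -- Commutation makes `v` shift all the nodes of the `e ^ n` translates of `ρ`, which take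
  -- infinitely many values at `j > k`, against `finite_coord`.
  have hpow : ∀ n : ℕ, Agree j ((e ^ n) ρ) ρ ∧ (e ^ n) ρ j = ρ j + n * (e ρ j - ρ j) := by
    intro n
    induction n with
    | zero => simpa using Agree.refl _ _
    | succ n ih =>
      rw [pow_succ', Equiv.Perm.mul_apply]
      refine ⟨(ih.1.map he).trans hjA, ?_⟩
      have h1 := shift_congr he ih.1
      have h2 := ih.2
      push_cast
      linear_combination h1 + h2
  refine Set.infinite_of_injective_forall_mem (f := fun n : ℕ => (e ^ n) ρ j) ?_ ?_
    (finite_coord hv hkj)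
  · intro m n hmn
    simp only [(hpow _).2] at hmn
    have : (m : ℤ) * (e ρ j - ρ j) = n * (e ρ j - ρ j) := by linarith
    exact_mod_cast mul_right_cancel₀ (sub_ne_zero.mpr hj) this
  · intro n
    refine ⟨_, rfl, ?_⟩
    have hc : v * e ^ n = e ^ n * v := ((show Commute e v from hcomm).symm.pow_right n).eq
    have h1 : v ((e ^ n) ρ) = (e ^ n) (v ρ) := by
      rw [← Equiv.Perm.mul_apply, hc, Equiv.Perm.mul_apply]
    have h2 := shift_congr (pow_mem he n) hvρ
    rw [h1]
    omega

theorem commute_of_disjoint {α : Type*} {c d : Equiv.Perm α} (h : ∀ x, c x ≠ x → d x = x) :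
    c * d = d * c :=
  (Equiv.Perm.Disjoint.commute fun x => or_iff_not_imp_left.mpr (h x)).eq

theorem exists_moved_of_not_commute {α : Type*} {c d : Equiv.Perm α} (h : c * d ≠ d * c) :
    ∃ x, c x ≠ x ∧ d x ≠ x := by
  by_contra! hc
  exact h (commute_of_disjoint hc)

theorem eq_self_of_commute [Finite ι] {e v : Equiv.Perm (ι → ℤ)} (he : e ∈ Gr ι) (hv : v ∈ Gr ι)
    {k : ι} {ρ : ι → ℤ} (hcomm : e * v = v * e) (hvρ : Agree k (v ρ) ρ) (hvk : v ρ k ≠ ρ k)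
    (hek : e ρ k = ρ k) {ω : ι → ℤ} (hω : Agree k ω ρ) : e ω = ω :=
  eq_self_of_comm he hv hvρ hvk (fixes_of_comm he hv hvρ hvk hcomm) hek
    (fun ω _ => by rw [← Equiv.Perm.mul_apply, hcomm, Equiv.Perm.mul_apply]) hω

theorem pow_shift {e : Equiv.Perm (ι → ℤ)} (he : e ∈ Gr ι) {k : ι} {ρ : ι → ℤ}
    (heρ : Agree k (e ρ) ρ) (n : ℕ) {ω : ι → ℤ} (hω : Agree k ω ρ) :
    Agree k ((e ^ n) ω) ρ ∧ (e ^ n) ω k = ω k + n * (e ρ k - ρ k) := by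
  induction n with
  | zero => simpa using hω
  | succ n ih =>
    rw [pow_succ', Equiv.Perm.mul_apply]
    refine ⟨(ih.1.map he).trans heρ, ?_⟩
    have h1 := shift_congr he ih.1
    have h2 := ih.2
    push_cast
    linear_combination h1 + h2

theorem zpow_shift {e : Equiv.Perm (ι → ℤ)} (he : e ∈ Gr ι) {k : ι} {ρ : ι → ℤ}
    (heρ : Agree k (e ρ) ρ) (n : ℤ) {ω : ι → ℤ} (hω : Agree k ω ρ) :
    Agree k ((e ^ n) ω) ρ ∧ (e ^ n) ω k = ω k + n * (e ρ k - ρ k) := by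
  obtain ⟨n, rfl | rfl⟩ := n.eq_nat_or_neg
  · simpa using pow_shift he heρ n hω
  · have h1 : Agree k ((e ^ (-(n : ℤ))) ω) ρ := by
      have h2 := (hω.trans (pow_shift he heρ n (Agree.refl k ρ)).1.symm).map
        (zpow_mem he (-(n : ℤ)))
      have h3 : (e ^ (-(n : ℤ))) ((e ^ n) ρ) = ρ := by
        rw [zpow_neg, zpow_natCast, inv_apply_self']
      rwa [h3] at h2
    refine ⟨h1, ?_⟩
    have h4 := (pow_shift he heρ n h1).2
    have h5 : (e ^ n) ((e ^ (-(n : ℤ))) ω) = ω := by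
      rw [zpow_neg, zpow_natCast, apply_inv_self']
    rw [h5] at h4
    linear_combination -h4

theorem tau_zero_agree (c : ι) : Agree c (tau c 0) 0 := by
  rw [tau_apply, tauFun_of_agree (Agree.refl c 0)]
  exact agree_add_single c 1 0

theorem tau_zero_apply (c : ι) : tau c 0 c ≠ (0 : ι → ℤ) c := by
  rw [tau_apply, tauFun_of_agree (Agree.refl c 0)]
  simp

theorem agree_of_tau_ne {c : ι} {ω : ι → ℤ} (h : tau c ω ≠ ω) : Agree c ω 0 := by
  by_contra hc
  exact h (tauFun_of_not_agree hc 1)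

/-- A generator, as an element of the iterated wreath product. -/
noncomputable def tauGr (c : ι) : Gr ι := ⟨tau c, tau_mem c⟩

/-- The elements that are trivial on the orbital of a generator. -/
def fixer (x : ι) : Subgroup (Gr ι) where
  carrier := {g | ∀ ω, Agree x ω 0 → g.1 ω = ω}
  one_mem' := fun _ _ => rfl
  mul_mem' := fun {a b} ha hb ω h => by
    change a.1 (b.1 ω) = ω
    rw [hb ω h, ha ω h]
  inv_mem' := fun {a} ha ω h => by
    change (a.1)⁻¹ ω = ω
    conv_lhs => rw [← ha ω h]
    exact inv_apply_self' _ _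

theorem mem_fixer {x : ι} {g : Gr ι} : g ∈ fixer x ↔ ∀ ω, Agree x ω 0 → g.1 ω = ω := Iff.rfl

/-- An element all of whose orbitals have the same depth lies in every subgroup that contains
its restrictions to these orbitals. -/
theorem mem_of_forall_isRestr [Finite ι] (S : Subgroup (Gr ι)) {a : Gr ι} {k : ι}
    (htop : ∀ ω, Agree k (a.1 ω) ω) (huni : ∀ ω, a.1 ω ≠ ω → a.1 ω k ≠ ω k)
    (hS : ∀ ρ, a.1 ρ k ≠ ρ k → ∀ c : Gr ι, IsRestr k ρ a.1 c.1 → c ∈ S) : a ∈ S := by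
  have key : ∀ (F : Finset (ι → ℤ)) (a : Gr ι), (∀ ω, Agree k (a.1 ω) ω) →
      (∀ ω, a.1 ω ≠ ω → a.1 ω k ≠ ω k) →
      (∀ ρ, a.1 ρ k ≠ ρ k → ∀ c : Gr ι, IsRestr k ρ a.1 c.1 → c ∈ S) →
      (∀ ω, a.1 ω k ≠ ω k → trunc k ω ∈ F) → a ∈ S := by
    classical
    intro F
    induction F using Finset.induction_on with
    | empty =>
      intro a _ huni _ hF
      have : a = 1 := Subtype.ext (Equiv.ext fun ω => by
        by_contra hne
        exact absurd (hF ω (huni ω hne)) (Finset.notMem_empty _))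
      rw [this]
      exact one_mem S
    | insert ρ F _ ih =>
      intro a htop huni hS hF
      by_cases hρ : a.1 ρ k = ρ k
      · refine ih a htop huni hS fun ω hω => ?_
        refine (Finset.mem_insert.mp (hF ω hω)).resolve_left fun h => hω ?_
        have := shift_congr a.2 (agree_trunc k ω)
        rw [h] at this
        omega
      -- Dividing by the restriction `c` removes the node of `ρ` from the finite set of shifted
      -- nodes and leaves the other restrictions unchanged.
      · obtain ⟨c, hc, hcr⟩ := exists_isRestr a.2 (htop ρ)
        have hcS := hS ρ hρ ⟨c, hc⟩ hcr
        have hon : ∀ ω, Agree k ω ρ → c⁻¹ (a.1 ω) = ω := fun ω h => by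
          rw [← hcr.on ω h, inv_apply_self']
        have hoff : ∀ ω, ¬ Agree k ω ρ → c⁻¹ (a.1 ω) = a.1 ω := fun ω h => by
          conv_lhs => rw [← hcr.off (a.1 ω) (fun h' => h ((htop ω).symm.trans h'))]
          exact inv_apply_self' _ _
        have hmem : (⟨c, hc⟩ : Gr ι)⁻¹ * a ∈ S := by
          refine ih _ (fun ω => ?_) (fun ω hω => ?_) (fun ω hω d hd => ?_) (fun ω hω => ?_)
          · change Agree k (c⁻¹ (a.1 ω)) ω
            by_cases h : Agree k ω ρ
            · rw [hon ω h]; exact Agree.refl _ _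
            · rw [hoff ω h]; exact htop ω
          · change c⁻¹ (a.1 ω) ≠ ω at hω
            change c⁻¹ (a.1 ω) k ≠ ω k
            by_cases h : Agree k ω ρ
            · exact absurd (hon ω h) hω
            · rw [hoff ω h] at hω ⊢; exact huni ω hω
          · change c⁻¹ (a.1 ω) k ≠ ω k at hω
            have h : ¬ Agree k ω ρ := fun h => hω (by rw [hon ω h])
            rw [hoff ω h] at hω
            refine hS ω hω d ⟨fun ω' h' => ?_, hd.off⟩
            rw [hd.on ω' h']
            exact hoff ω' fun h'' => h (h'.symm.trans h'')
          · change c⁻¹ (a.1 ω) k ≠ ω k at hω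
            have h : ¬ Agree k ω ρ := fun h => hω (by rw [hon ω h])
            rw [hoff ω h] at hω
            refine (Finset.mem_insert.mp (hF ω hω)).resolve_left fun h' => h ?_
            rw [← h']
            exact (agree_trunc k ω).symm
        simpa using S.mul_mem hcS hmem
  refine key (finite_trunc a.2 k).toFinset a htop huni hS fun ω hω => ?_
  rw [Set.Finite.mem_toFinset]
  exact ⟨ω, rfl, hω⟩

/-! ### Elements mapped to generators by an injective homomorphism -/

variable {κ : Type*} [LinearOrder κ]

theorem exists_top [Finite ι] {a : Gr ι} (ha : a ≠ 1) :
    ∃ k, (∀ ω, Agree k (a.1 ω) ω) ∧ ∃ ω, a.1 ω k ≠ ω k := by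
  have hne : {k | ∃ ω, a.1 ω k ≠ ω k}.Nonempty := by
    by_contra hc
    rw [Set.not_nonempty_iff_eq_empty] at hc
    refine ha (Subtype.ext (Equiv.ext fun ω => funext fun k => by_contra fun hk => ?_))
    exact (hc ▸ (⟨ω, hk⟩ : k ∈ {k | ∃ ω, a.1 ω k ≠ ω k}) : k ∈ (∅ : Set ι))
  obtain ⟨k, hk⟩ := (Set.toFinite {k | ∃ ω, a.1 ω k ≠ ω k}).exists_maximal hne
  refine ⟨k, fun ω j hj => ?_, hk.prop⟩
  by_contra hc
  exact absurd (hk.le_of_ge ⟨ω, hc⟩ hj.le) (not_le.mpr hj)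

theorem not_commute_map {G H : Type*} [Group G] [Group H] {ψ : G →* H}
    (hψ : Function.Injective ψ) {a b : G} (h : a * b ≠ b * a) : ψ a * ψ b ≠ ψ b * ψ a := by
  rw [← map_mul, ← map_mul]
  exact fun h' => h (hψ h')

theorem perm_not_commute {a b : Gr ι} (h : a * b ≠ b * a) : a.1 * b.1 ≠ b.1 * a.1 :=
  fun h' => h (Subtype.ext h')

/-- If an injective homomorphism maps `a` to a generator, then some restriction of `a` to an
orbital of the largest depth is mapped to an element that is nontrivial on the orbital of the
generator. -/
theorem exists_restr_notMem_fixer [Finite ι] [Finite κ] {ψ : Gr ι →* Gr κ}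
    (hψ : Function.Injective ψ) {a : Gr ι} {x : κ} (hax : ψ a = tauGr x) {k : ι}
    (htop : ∀ ω, Agree k (a.1 ω) ω) (hk : ∃ ω, a.1 ω k ≠ ω k) :
    ∃ ρ, a.1 ρ k ≠ ρ k ∧ ∃ c : Gr ι, IsRestr k ρ a.1 c.1 ∧ ψ c ∉ fixer x := by
  by_contra! H
  by_cases huni : ∀ ω, a.1 ω ≠ ω → a.1 ω k ≠ ω k
  · have := mem_of_forall_isRestr ((fixer x).comap ψ) htop huni H
    rw [Subgroup.mem_comap, hax] at this
    exact tau_zero_apply x (congrFun (this 0 (Agree.refl _ _)) x)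
  -- Here `a` moves some `ω₁` without shifting it at `k`. A conjugate `d` of `a` does the same at
  -- `ρ`, so it commutes neither with `a` nor with the restriction `c`. The first fact forces the
  -- support of `ψ d` into the orbital of `tau x`; by the second, `ψ c` moves a point of that
  -- support.
  · push Not at huni
    obtain ⟨ω₁, hω₁, hω₁k⟩ := huni
    obtain ⟨ρ, hρ⟩ := hk
    obtain ⟨E, hE, hEω⟩ := exists_map_eq ω₁ ρ
    obtain ⟨c, hc, hcr⟩ := exists_isRestr a.2 (htop ρ)
    have hcρ := hcr.on ρ (Agree.refl _ _)
    have hmem := H ρ hρ ⟨c, hc⟩ hcr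
    set E' : Gr ι := ⟨E, hE⟩
    set d : Gr ι := E' * a * E'⁻¹ with hd
    have hE'ρ : E⁻¹ ρ = ω₁ := by rw [← hEω, inv_apply_self']
    have hdρ : d.1 ρ = E (a.1 ω₁) := by
      change E (a.1 (E⁻¹ ρ)) = _
      rw [hE'ρ]
    have hdρ_ne : d.1 ρ ≠ ρ := by
      rw [hdρ, ← hEω]
      exact fun h => hω₁ (E.injective h)
    have hdρ_k : d.1 ρ k = ρ k := by
      have := shift_congr hE (htop ω₁)
      rw [hdρ]
      rw [hEω] at this
      omega
    have h1 : ¬ (a * d = d * a) := fun h => hdρ_ne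
      (eq_self_of_commute d.2 a.2 (congrArg Subtype.val h).symm (htop ρ) hρ hdρ_k
        (Agree.refl _ _))
    have h2 : ¬ ((⟨c, hc⟩ : Gr ι) * d = d * ⟨c, hc⟩) := fun h => hdρ_ne
      (eq_self_of_commute d.2 hc (congrArg Subtype.val h).symm (by rw [hcρ]; exact htop ρ)
        (by rw [hcρ]; exact hρ) hdρ_k (Agree.refl _ _))
    have hψd : ∀ ω, (ψ d).1 ω ≠ ω → Agree x ((ψ E').1⁻¹ ω) 0 := by
      intro ω h
      refine agree_of_tau_ne fun h' => h ?_
      rw [hd, map_mul, map_mul, map_inv, hax]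
      change (ψ E').1 (tau x ((ψ E').1⁻¹ ω)) = ω
      rw [h', apply_inv_self']
    obtain ⟨ω, hω, hω'⟩ := exists_moved_of_not_commute (perm_not_commute (not_commute_map hψ h1))
    obtain ⟨ν, hν, hν'⟩ := exists_moved_of_not_commute (perm_not_commute (not_commute_map hψ h2))
    rw [hax] at hω
    have h3 := ((hψd ν hν').trans (hψd ω hω').symm)
    rw [agree_map_iff (inv_mem (ψ E').2)] at h3
    exact hν (hmem ν (h3.trans (agree_of_tau_ne hω)))

/-- The orbital of largest depth of an element mapped to a generator is unique, if an element
supported properly inside of it is mapped to an element that moves points of the orbital of the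
generator without shifting it. -/
theorem agree_of_bump [Finite ι] [Finite κ] {ψ : Gr ι →* Gr κ}
    {b : Gr ι} {y : κ} (hby : ψ b = tauGr y) {k : ι}
    (htop : ∀ ω, Agree k (b.1 ω) ω) {ρ : ι → ℤ} (hρ : b.1 ρ k ≠ ρ k) {B A : Gr ι} (hBr : IsRestr k ρ b.1 B.1)
    (hBy : Agree y ((ψ B).1 0) 0) (hBy' : (ψ B).1 0 y ≠ 0) {n : ℤ}
    (hA : ∀ ω, A.1 ω ≠ ω → Agree k ω ρ ∧ ω k = n) (hAy : (ψ A).1 0 y = 0)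
    (hAfix : ψ A ∉ fixer y) {σ : ι → ℤ} (hσ : b.1 σ k ≠ σ k) : Agree k σ ρ := by
  by_contra hσρ
  obtain ⟨E₀, hE₀, hEρ⟩ := exists_map_eq ρ σ
  set E : Gr ι := ⟨E₀, hE₀⟩
  have hEσ : E.1⁻¹ σ = ρ := by rw [← hEρ]; exact inv_apply_self' _ _
  have hEmap : ∀ ω, Agree k (E.1⁻¹ ω) ρ → Agree k ω σ := by
    intro ω h
    rw [← hEσ] at h
    exact (agree_map_iff (inv_mem E.2)).mp h
  obtain ⟨B₂₀, hB₂₀, hB₂r⟩ := exists_isRestr b.2 (htop σ)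
  set B₂ : Gr ι := ⟨B₂₀, hB₂₀⟩
  have hBsupp : ∀ ω, B.1 ω ≠ ω → Agree k ω ρ := fun ω h => by
    by_contra hc
    exact h (hBr.off ω hc)
  -- elements commuting with the conjugates of `A` and `B` are trivial on the translated orbital
  have T : ∀ g : Gr ι, (∀ ω, Agree k ω σ → g.1 ω = ω) →
      ∀ ω, Agree y ((ψ E).1⁻¹ ω) 0 → (ψ g).1 ω = ω := by
    intro g hg ω hω
    have hcomm : ∀ c : Gr ι, (∀ ω, c.1 ω ≠ ω → Agree k ω ρ) →
        (E⁻¹ * g * E) * c = c * (E⁻¹ * g * E) := by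
      intro c hc
      refine Subtype.ext (commute_of_disjoint (c := c.1) (d := (E⁻¹ * g * E).1) ?_).symm
      intro ω h
      change E.1⁻¹ (g.1 (E.1 ω)) = ω
      rw [hg, inv_apply_self']
      rw [← hEρ]
      exact (hc ω h).map hE₀
    have hcψ : ∀ c : Gr ι, (∀ ω, c.1 ω ≠ ω → Agree k ω ρ) →
        (ψ (E⁻¹ * g * E)).1 * (ψ c).1 = (ψ c).1 * (ψ (E⁻¹ * g * E)).1 := by
      intro c hc
      have := congrArg (fun z => (ψ z).1) (hcomm c hc)
      simpa only [map_mul, Subgroup.coe_mul] using this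
    have hB := hcψ B hBsupp
    have hA' := hcψ A (fun ω h => (hA ω h).1)
    -- `w'` fixes the node, as it commutes with `ψ B`. It cannot shift the node, or `ψ A` would be
    -- trivial on it; commuting with `ψ B` then makes `w'` trivial there.
    set w' := ψ (E⁻¹ * g * E) with hw'
    have hfix : Agree y (w'.1 0) 0 := fixes_of_comm w'.2 (ψ B).2 hBy hBy' hB
    have hzero : w'.1 0 y = 0 := by
      by_contra hne
      exact hAfix fun ω hω => eq_self_of_commute (ψ A).2 w'.2 hA'.symm hfix hne hAy hω
    have h := eq_self_of_commute w'.2 (ψ B).2 hB hBy hBy' hzero hω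
    have h' : w'.1 ((ψ E).1⁻¹ ω) = (ψ E).1⁻¹ ((ψ g).1 ω) := by
      rw [hw', map_mul, map_mul, map_inv]
      change (ψ E).1⁻¹ ((ψ g).1 ((ψ E).1 ((ψ E).1⁻¹ ω))) = _
      rw [apply_inv_self']
    rw [h'] at h
    exact (ψ E).1⁻¹.injective h
  have hrest := T (B₂⁻¹ * b) fun ω h => by
    change B₂₀⁻¹ (b.1 ω) = ω
    rw [← hB₂r.on ω h, inv_apply_self']
  have hBT := T B fun ω h => hBr.off ω fun h' => hσρ (h.symm.trans h')
  -- Otherwise the image of the conjugate `B₃` of `B₂` is trivial on the orbital of `tau y`. Since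
  -- `B` and `B₃` shift the node of `ρ` by `q'`-and-`q`-commensurable amounts, `B₃ ^ q * B ^ (-q')`
  -- does not shift it, yet its image acts on the orbital of `tau y` as a nontrivial power of `ψ B`.
  have hB₂ : ∃ ω, Agree y ((ψ E).1⁻¹ ω) 0 ∧ (ψ B₂).1 ω ≠ ω := by
    by_contra! hc
    set B₃ : Gr ι := E⁻¹ * B₂ * E with hB₃
    have hB₃y : ψ B₃ ∈ fixer y := by
      intro ω hω
      rw [hB₃, map_mul, map_mul, map_inv]
      change (ψ E).1⁻¹ ((ψ B₂).1 ((ψ E).1 ω)) = ω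
      rw [hc _ (by rwa [inv_apply_self']), inv_apply_self']
    have hB₃supp : ∀ ω, ¬ Agree k ω ρ → B₃.1 ω = ω := by
      intro ω h
      change E.1⁻¹ (B₂₀ (E.1 ω)) = ω
      rw [hB₂r.off, inv_apply_self']
      intro h'
      rw [← hEρ] at h'
      exact h ((agree_map_iff hE₀).mp h')
    have hB₃ρ : B₃.1 ρ = E.1⁻¹ (b.1 σ) := by
      change E.1⁻¹ (B₂₀ (E₀ ρ)) = _
      rw [hEρ, hB₂r.on σ (Agree.refl _ _)]
    have hB₃fix : Agree k (B₃.1 ρ) ρ := by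
      rw [hB₃ρ, ← hEσ]
      exact (htop σ).map (inv_mem E.2)
    have hB₃k : B₃.1 ρ k - ρ k ≠ 0 := by
      have := shift_congr (inv_mem E.2) (htop σ)
      rw [hEσ, ← hB₃ρ] at this
      omega
    have hBρ := hBr.on ρ (Agree.refl _ _)
    have hBfix : Agree k (B.1 ρ) ρ := by rw [hBρ]; exact htop ρ
    have hBk : B.1 ρ k - ρ k ≠ 0 := by
      rw [hBρ]
      omega
    set q := B.1 ρ k - ρ k with hq
    set q' := B₃.1 ρ k - ρ k with hq'
    set c₁ : Gr ι := B₃ ^ q * B ^ (-q') with hc₁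
    have hc₁ρ : Agree k (c₁.1 ρ) ρ ∧ c₁.1 ρ k = ρ k := by
      have h1 := zpow_shift B.2 hBfix (-q') (Agree.refl k ρ)
      have h2 := zpow_shift B₃.2 hB₃fix q h1.1
      refine ⟨h2.1, ?_⟩
      change (B₃.1 ^ q) ((B.1 ^ (-q')) ρ) k = ρ k
      rw [h2.2, h1.2, ← hq, ← hq']
      ring
    have hc₁supp : ∀ ω, c₁.1 ω ≠ ω → Agree k ω ρ := by
      intro ω h
      by_contra hω
      refine h ?_
      change (B₃.1 ^ q) ((B.1 ^ (-q')) ω) = ω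
      rw [Equiv.Perm.zpow_apply_eq_self_of_apply_eq_self (hBr.off ω hω),
        Equiv.Perm.zpow_apply_eq_self_of_apply_eq_self (hB₃supp ω hω)]
    have hψc₁ : ∀ ω, Agree y ω 0 → (ψ c₁).1 ω = ((ψ B).1 ^ (-q')) ω := by
      intro ω hω
      have h1 := (zpow_shift (ψ B).2 hBy (-q') hω).1
      rw [hc₁, map_mul, map_zpow, map_zpow]
      exact mem_fixer.mp (zpow_mem hB₃y q) _ h1
    -- `c₁` moves points over finitely many values at `k` only, so conjugation by some `B ^ r` makes
    -- its support miss the value `n`, hence the support of `A`. The conjugate commutes with `A`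
    -- while its image shifts the orbital of `tau y`.
    obtain ⟨r, hr⟩ : ∃ r : ℕ, ¬ ∃ ω, Agree k ω ρ ∧ ω k = n - r * q ∧ c₁.1 ω ≠ ω := by
      by_contra! hc
      refine Set.infinite_of_injective_forall_mem (f := fun r : ℕ => n - r * q) ?_ hc
        (finite_coord_of_fixes c₁.2 hc₁ρ.1 hc₁ρ.2)
      intro r s hrs
      have : (r : ℤ) * q = s * q := by
        have : n - r * q = n - s * q := hrs
        linarith
      exact_mod_cast mul_right_cancel₀ hBk this
    set d : Gr ι := B ^ (r : ℤ) * c₁ * B ^ (-(r : ℤ)) with hd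
    have hAd : A * d = d * A := by
      refine Subtype.ext (commute_of_disjoint (c := A.1) (d := d.1) fun ω h => ?_)
      obtain ⟨h1, h2⟩ := hA ω h
      have h3 := zpow_shift B.2 hBfix (-(r : ℤ)) h1
      change (B.1 ^ (r : ℤ)) (c₁.1 ((B.1 ^ (-(r : ℤ))) ω)) = ω
      have h4 : c₁.1 ((B.1 ^ (-(r : ℤ))) ω) = (B.1 ^ (-(r : ℤ))) ω := by
        by_contra hne
        refine hr ⟨_, h3.1, ?_, hne⟩
        rw [h3.2, h2]
        ring
      rw [h4, ← Equiv.Perm.mul_apply, ← zpow_add]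
      simp
    have hψd : (ψ d).1 0 = ((ψ B).1 ^ (-q')) 0 := by
      have h1 := (zpow_shift (ψ B).2 hBy (-(r : ℤ)) (Agree.refl y 0)).1
      rw [hd, map_mul, map_mul, map_zpow, map_zpow]
      change ((ψ B).1 ^ (r : ℤ)) ((ψ c₁).1 (((ψ B).1 ^ (-(r : ℤ))) 0)) = _
      rw [hψc₁ _ h1, ← Equiv.Perm.mul_apply, ← Equiv.Perm.mul_apply, ← zpow_add, ← zpow_add]
      congr 2
      ring
    have h1 := zpow_shift (ψ B).2 hBy (-q') (Agree.refl y 0)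
    rw [← hψd] at h1
    refine hAfix fun ω hω => eq_self_of_commute (ψ A).2 (ψ d).2 ?_ h1.1 ?_ hAy hω
    · have := congrArg (fun z => (ψ z).1) hAd
      simpa only [map_mul, Subgroup.coe_mul] using this
    · rw [h1.2]
      have : -q' * ((ψ B).1 0 y - (0 : κ → ℤ) y) ≠ 0 :=
        mul_ne_zero (neg_ne_zero.mpr hB₃k) (sub_ne_zero.mpr hBy')
      omega
  -- So `ψ b = tau y` moves a point of the translated orbital, which must therefore be the orbital
  -- of `tau y` itself; but `ψ B` is trivial on the former and shifts the latter.
  obtain ⟨ω, hω, hne⟩ := hB₂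
  have hb : (ψ b).1 ω ≠ ω := by
    have : (ψ b).1 ω = (ψ B₂).1 ((ψ (B₂⁻¹ * b)).1 ω) := by
      rw [← Equiv.Perm.mul_apply, ← Subgroup.coe_mul, ← map_mul, mul_inv_cancel_left]
    rw [this, hrest ω hω]
    exact hne
  rw [hby] at hb
  have h1 := (agree_of_tau_ne hb).map (inv_mem (ψ E).2)
  exact hBy' (congrFun (hBT 0 (h1.symm.trans hω)) y)

theorem IsRestr.commute {k : ι} {ρ : ι → ℤ} {a c : Equiv.Perm (ι → ℤ)} (h : IsRestr k ρ a c)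
    (htop : ∀ ω, Agree k (a ω) ω) : c * a = a * c := by
  refine Equiv.ext fun ω => ?_
  rw [Equiv.Perm.mul_apply, Equiv.Perm.mul_apply]
  by_cases hω : Agree k ω ρ
  · rw [h.on ω hω, h.on _ ((htop ω).trans hω)]
  · rw [h.off ω hω, h.off _ fun h' => hω ((htop ω).symm.trans h')]

/-- Conjugation by `tau y` moves the support of `tau x`, where place `y` is 0, to a set where place
`y` is 1. -/
theorem tau_conj_commute {x y : ι} (hxy : x < y) :
    (tauGr y * tauGr x * (tauGr y)⁻¹) * tauGr x = tauGr x * (tauGr y * tauGr x * (tauGr y)⁻¹) := by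
  refine (Subtype.ext (commute_of_disjoint (c := tau x) (d := tau y * tau x * (tau y)⁻¹)
    fun ω h => ?_)).symm
  change tau y (tau x ((tau y)⁻¹ ω)) = ω
  have h1 := agree_of_tau_ne h
  have h2 : tau x ((tau y)⁻¹ ω) = (tau y)⁻¹ ω := by
    by_contra hc
    have h3 := agree_of_tau_ne hc y hxy
    rw [tau_inv_apply, tauFun_of_agree (h1.mono hxy.le)] at h3
    have h4 := h1 y hxy
    simp [h4] at h3
  rw [h2, apply_inv_self']

/-- An injective homomorphism of iterated wreath products that maps `a` and `b` to generators,
the one of `a` below the one of `b`: then `b` has a unique orbital of largest depth, which is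
deeper than all the orbitals of `a`. -/
theorem exists_depth_lt [Finite ι] [Finite κ] {ψ : Gr ι →* Gr κ}
    (hψ : Function.Injective ψ) {a b : Gr ι} {x y : κ} (hxy : x < y) (hax : ψ a = tauGr x)
    (hby : ψ b = tauGr y) :
    ∃ k ρ, (∀ j, k ≤ j → ∀ ω, a.1 ω j = ω j) ∧ (∀ j, k < j → ∀ ω, b.1 ω j = ω j) ∧
      b.1 ρ k ≠ ρ k ∧ ∀ σ, b.1 σ k ≠ σ k → Agree k σ ρ := by
  have hne : ∀ (c : Gr ι) (z : κ), ψ c = tauGr z → c ≠ 1 := by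
    rintro c z hc rfl
    rw [map_one] at hc
    exact tau_zero_apply z (congrFun (congrArg (fun g : Gr κ => g.1 0) hc.symm) z)
  have hval : ∀ {c d : Gr ι}, c * d = d * c → (ψ c).1 * (ψ d).1 = (ψ d).1 * (ψ c).1 := by
    intro c d h
    have := congrArg (fun z => (ψ z).1) h
    simpa only [map_mul, Subgroup.coe_mul] using this
  obtain ⟨k, htopa, hka⟩ := exists_top (hne a x hax)
  obtain ⟨l, htopb, hlb⟩ := exists_top (hne b y hby)
  obtain ⟨ρ, hρ, A, hA, hAx⟩ := exists_restr_notMem_fixer hψ hax htopa hka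
  obtain ⟨σ, hσ, B, hB, hBy⟩ := exists_restr_notMem_fixer hψ hby htopb hlb
  have hAa : (ψ A).1 * tau x = tau x * (ψ A).1 := by
    have := hval (c := A) (d := a) (Subtype.ext (hA.commute htopa))
    rwa [hax] at this
  have hBb : (ψ B).1 * tau y = tau y * (ψ B).1 := by
    have := hval (c := B) (d := b) (Subtype.ext (hB.commute htopb))
    rwa [hby] at this
  have hA0 : Agree x ((ψ A).1 0) 0 :=
    fixes_of_comm (ψ A).2 (tau_mem x) (tau_zero_agree x) (tau_zero_apply x) hAa
  have hAy0 : (ψ A).1 0 y = 0 := hA0 y hxy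
  have hAy : ψ A ∉ fixer y := fun h => hAx fun ω hω => h ω (hω.mono hxy.le)
  have hB0 : Agree y ((ψ B).1 0) 0 :=
    fixes_of_comm (ψ B).2 (tau_mem y) (tau_zero_agree y) (tau_zero_apply y) hBb
  have hBy0 : (ψ B).1 0 y ≠ 0 := fun h => hBy fun ω hω =>
    eq_self_of_commute (ψ B).2 (tau_mem y) hBb (tau_zero_agree y) (tau_zero_apply y) h hω
  -- `b` moves the orbital of `A`
  have hkl : k < l := by
    by_contra hlk
    -- If `b` fixed all nodes of depth `k`, then `a⁻¹ * (b * a * b⁻¹)` would commute with `a`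
    -- without shifting the node of `ρ`, hence be trivial on it. Then `A` commutes with `b`, and `ψ
    -- A` is trivial on the orbital of `tau y`.
    have hbρ : ∀ ω, Agree k (b.1 ω) ω := fun ω => (htopb ω).mono (not_lt.mp hlk)
    have hconj : (b * a * b⁻¹) * a = a * (b * a * b⁻¹) := by
      apply hψ
      simp only [map_mul, map_inv, hax, hby]
      exact tau_conj_commute hxy
    set c : Gr ι := a⁻¹ * (b * a * b⁻¹) with hc
    have hca : c * a = a * c := by
      rw [hc, mul_assoc, hconj, inv_mul_cancel_left, mul_inv_cancel_left]
    have hck : c.1 ρ k = ρ k := by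
      change a.1⁻¹ (b.1 (a.1 (b.1⁻¹ ρ))) k = ρ k
      have h1 : Agree k (b.1⁻¹ ρ) ρ := by
        have := hbρ (b.1⁻¹ ρ)
        rw [apply_inv_self'] at this
        exact this.symm
      have h2 := shift_congr a.2 h1
      have h3 := shift_congr b.2 ((htopa (b.1⁻¹ ρ)))
      rw [apply_inv_self'] at h3
      have h4 : Agree k (b.1 (a.1 (b.1⁻¹ ρ))) (a.1 ρ) :=
        (hbρ _).trans (h1.map a.2)
      have h5 := shift_congr (inv_mem a.2) h4
      rw [inv_apply_self'] at h5
      omega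
    have hcρ : ∀ ω, Agree k ω ρ → c.1 ω = ω := fun ω hω =>
      eq_self_of_commute c.2 a.2 (congrArg Subtype.val hca) (htopa ρ) hρ hck hω
    have hAb : A * b = b * A := by
      refine Subtype.ext (Equiv.ext fun ω => ?_)
      change A.1 (b.1 ω) = b.1 (A.1 ω)
      by_cases hω : Agree k ω ρ
      · have hω' := (hbρ ω).trans hω
        rw [hA.on ω hω, hA.on _ hω']
        have h1 := hcρ _ hω'
        change a.1⁻¹ (b.1 (a.1 (b.1⁻¹ (b.1 ω)))) = b.1 ω at h1
        rw [inv_apply_self'] at h1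
        conv_lhs => rw [← h1]
        exact apply_inv_self' _ _
      · rw [hA.off ω hω, hA.off _ fun h => hω ((hbρ ω).symm.trans h)]
    have h1 := hval hAb
    rw [hby] at h1
    exact hAy fun ω hω => eq_self_of_commute (ψ A).2 (tau_mem y) h1 (tau_zero_agree y)
      (tau_zero_apply y) hAy0 hω
  -- Noncommutation makes the supports of `A` and `B` meet, so the node of `A` lies in that of `B`,
  -- with the constant value `ρ l` at place `l`.
  have hAB : A * B ≠ B * A := fun h => hAy fun ω hω =>
    eq_self_of_commute (ψ A).2 (ψ B).2 (hval h) hB0 hBy0 hAy0 hω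
  obtain ⟨ω, hω, hω'⟩ := exists_moved_of_not_commute (perm_not_commute hAB)
  have h1 : Agree k ω ρ := by
    by_contra hc
    exact hω (hA.off ω hc)
  have h2 : Agree l ω σ := by
    by_contra hc
    exact hω' (hB.off ω hc)
  refine ⟨l, σ, fun j hj ν => htopa ν j (hkl.trans_le hj), fun j hj ν => htopb ν j hj, hσ,
    fun ν hν => agree_of_bump hby htopb hσ hB hB0 hBy0 (A := A) (n := ρ l) (fun ν hν => ?_)
      hAy0 hAy hν⟩
  have h3 : Agree k ν ρ := by
    by_contra hc
    exact hν (hA.off ν hc)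
  exact ⟨((h3.trans h1.symm).mono hkl.le).trans h2, h3 l hkl⟩

/-! ### Exponent sums and levels -/

open Classical in
/-- The sequence that vanishes up to `k` and is given by `ν` above `k`. -/
noncomputable def extend (k : ι) (ν : {j // k < j} → ℤ) : ι → ℤ :=
  fun j => if h : k < j then ν ⟨j, h⟩ else 0

/-- The part of a sequence above `k`. -/
def above (k : ι) (ω : ι → ℤ) : {j // k < j} → ℤ := fun j => ω j

theorem above_extend (k : ι) (ν : {j // k < j} → ℤ) : above k (extend k ν) = ν := by
  funext j
  simp [above, extend, j.2]

theorem agree_extend_above (k : ι) (ω : ι → ℤ) : Agree k (extend k (above k ω)) ω := by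
  intro j hj
  simp [above, extend, hj]

theorem extend_self (k : ι) (ν : {j // k < j} → ℤ) : extend k ν k = 0 := by simp [extend]

theorem above_congr {k : ι} {ω ω' : ι → ℤ} (h : Agree k ω ω') : above k ω = above k ω' :=
  funext fun j => h j j.2

/-- The permutation of the nodes of depth `k` induced by an element. -/
noncomputable def nodePerm (k : ι) (b : Gr ι) : Equiv.Perm ({j // k < j} → ℤ) where
  toFun ν := above k (b.1 (extend k ν))
  invFun ν := above k (b.1⁻¹ (extend k ν))
  left_inv ν := by
    dsimp only
    rw [above_congr ((agree_extend_above k _).map (inv_mem b.2)), inv_apply_self', above_extend]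
  right_inv ν := by
    dsimp only
    rw [above_congr ((agree_extend_above k _).map b.2), apply_inv_self', above_extend]

/-- The exponent sum at `k`: the sum of the shifts of all the nodes of depth `k`. -/
noncomputable def eps (k : ι) (a : Gr ι) : ℤ := ∑ᶠ ν : {j // k < j} → ℤ, a.1 (extend k ν) k

theorem finite_support_shift (k : ι) (a : Gr ι) :
    (Function.support fun ν : {j // k < j} → ℤ => a.1 (extend k ν) k).Finite := by
  refine ((finite_trunc a.2 k).image (above k)).subset fun ν hν => ?_
  refine ⟨trunc k (extend k ν), ⟨_, rfl, ?_⟩, ?_⟩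
  · rw [extend_self]
    exact hν
  · rw [above_congr (agree_trunc k _), above_extend]

/-- Shifts satisfy a cocycle identity, and summing over all nodes absorbs the permutation of the
nodes by `b`. -/
theorem eps_mul (k : ι) (a b : Gr ι) : eps k (a * b) = eps k a + eps k b := by
  have h : ∀ ν, (a * b).1 (extend k ν) k =
      a.1 (extend k (nodePerm k b ν)) k + b.1 (extend k ν) k := by
    intro ν
    have := shift_congr a.2 (agree_extend_above k (b.1 (extend k ν)))
    rw [extend_self] at this
    change a.1 (b.1 (extend k ν)) k = a.1 (extend k (above k (b.1 (extend k ν)))) k + _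
    omega
  unfold eps
  rw [finsum_congr h, finsum_add_distrib _ (finite_support_shift k b)]
  · rw [finsum_comp_equiv (nodePerm k b) (f := fun ν => a.1 (extend k ν) k)]
  · exact (finite_support_shift k a).preimage (nodePerm k b).injective.injOn

theorem eps_one (k : ι) : eps k (1 : Gr ι) = 0 := by
  have := eps_mul k 1 1
  rw [one_mul] at this
  omega

theorem eps_inv (k : ι) (a : Gr ι) : eps k a⁻¹ = - eps k a := by
  have := eps_mul k a a⁻¹
  rw [mul_inv_cancel, eps_one] at this
  omega

theorem eps_eq_zero {k : ι} {a : Gr ι} (h : ∀ ω, a.1 ω k = ω k) : eps k a = 0 := by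
  unfold eps
  rw [finsum_congr (g := fun _ => 0) fun ν => by rw [h, extend_self]]
  exact finsum_zero

theorem eps_eq_of_unique {k : ι} {a : Gr ι} {ρ : ι → ℤ}
    (h : ∀ σ, a.1 σ k ≠ σ k → Agree k σ ρ) : eps k a = a.1 ρ k - ρ k := by
  unfold eps
  rw [finsum_eq_single _ (above k ρ)]
  · have := shift_congr a.2 (agree_extend_above k ρ)
    rw [extend_self] at this
    omega
  · intro ν hν
    by_contra hne
    rw [← extend_self k ν] at hne
    refine hν ?_
    rw [← above_congr (h _ hne), above_extend]

theorem eps_tau_self (k : ι) : eps k (tauGr k) = 1 := by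
  rw [eps_eq_of_unique (ρ := 0)]
  · change tau k 0 k - 0 = 1
    rw [tau_apply, tauFun_of_agree (Agree.refl _ _)]
    simp
  · intro σ h
    exact agree_of_tau_ne fun h' => h (congrFun h' k)

theorem eps_tau_of_ne {k c : ι} (h : k ≠ c) : eps k (tauGr c) = 0 :=
  eps_eq_zero fun ω => tauFun_apply_of_ne h 1 ω

theorem Gr_hom_induction {p : Gr ι → Prop} (gen : ∀ c, p (tauGr c)) (one : p 1)
    (mul : ∀ a b, p a → p b → p (a * b)) (inv : ∀ a, p a → p a⁻¹) (a : Gr ι) : p a := by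
  obtain ⟨a, ha⟩ := a
  induction ha using Subgroup.closure_induction with
  | mem a ha =>
    obtain ⟨c, rfl⟩ := ha
    exact gen c
  | one => exact one
  | mul a b ha hb iha ihb => exact mul _ _ iha ihb
  | inv a ha ih => exact inv _ ih

theorem eps_map [Fintype ι] (ψ : Gr ι →* Gr κ) (z : κ) (a : Gr ι) :
    eps z (ψ a) = ∑ y, eps y a * eps z (ψ (tauGr y)) := by
  classical
  induction a using Gr_hom_induction with
  | gen c =>
    rw [Finset.sum_eq_single c, eps_tau_self, one_mul]
    · intro b _ hb
      rw [eps_tau_of_ne hb, zero_mul]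
    · simp
  | one => simp [eps_one]
  | mul a b iha ihb => simp [eps_mul, iha, ihb, add_mul, Finset.sum_add_distrib]
  | inv a ih => simp [eps_inv, ih, neg_mul, Finset.sum_neg_distrib]

/-- The largest place with nonzero exponent sum is `k`. -/
def IsLevel (a : Gr ι) (k : ι) : Prop := eps k a ≠ 0 ∧ ∀ j, k < j → eps j a = 0

theorem IsLevel.unique {a : Gr ι} {k l : ι} (hk : IsLevel a k) (hl : IsLevel a l) : k = l := by
  rcases lt_trichotomy k l with h | h | h
  · exact absurd (hk.2 l h) hl.1
  · exact h
  · exact absurd (hl.2 k h) hk.1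

theorem exists_isLevel [Finite ι] {a : Gr ι} (h : ∃ k, eps k a ≠ 0) : ∃ k, IsLevel a k := by
  obtain ⟨k, hk⟩ := (Set.toFinite {k | eps k a ≠ 0}).exists_maximal h
  refine ⟨k, hk.prop, fun j hj => ?_⟩
  by_contra hc
  exact absurd (hk.le_of_ge hc hj.le) (not_le.mpr hj)

variable {α : Type*} [LinearOrder α]

/-- A homomorphism with a left inverse up to inclusion preserves the order of levels. -/
theorem exists_strictMono_level [Finite ι] [Finite κ] {f : Gr α →* Gr ι} {g : Gr ι →* Gr κ}
    (hg : Function.Injective g) {inc : α → κ} (hinc : StrictMono inc)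
    (hfg : ∀ x, g (f (tauGr x)) = tauGr (inc x)) :
    ∃ f' : α → ι, StrictMono f' ∧ ∀ x, IsLevel (f (tauGr x)) (f' x) := by
  have := Fintype.ofFinite ι
  have hex : ∀ x, ∃ k, IsLevel (f (tauGr x)) k := by
    intro x
    refine exists_isLevel ?_
    by_contra! hc
    -- The image under `g` has exponent sum 1 at `inc x`, so the exponent sums of `f (tauGr x)`
    -- cannot all vanish.
    have h := eps_map g (inc x) (f (tauGr x))
    rw [hfg, eps_tau_self] at h
    simp [hc] at h
  choose f' hf' using hex
  refine ⟨f', fun x y hxy => ?_, hf'⟩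
  obtain ⟨k, ρ, h1, h2, h3, h4⟩ := exists_depth_lt hg (hinc hxy) (hfg x) (hfg y)
  have hy : f' y = k := (hf' y).unique
    ⟨by rw [eps_eq_of_unique h4]; exact sub_ne_zero.mpr h3, fun j hj => eps_eq_zero (h2 j hj)⟩
  rw [hy]
  by_contra hc
  exact (hf' x).1 (eps_eq_zero (h1 _ (not_lt.mp hc)))

/-- Levels of composites: if generators are mapped to elements whose levels increase, then the
level of the image of an element is the image of its level. -/
theorem IsLevel.map [Finite ι] {g : Gr ι →* Gr κ} {g' : ι → κ} (hmono : StrictMono g')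
    (hg : ∀ y, IsLevel (g (tauGr y)) (g' y)) {a : Gr ι} {k : ι} (h : IsLevel a k) :
    IsLevel (g a) (g' k) := by
  have := Fintype.ofFinite ι
  -- Triangularity: places below `k` contribute nothing at `z` because `g'` is increasing, places
  -- above `k` because `a` has level `k`.
  have hsum : ∀ z, g' k ≤ z → eps z (g a) = eps k a * eps z (g (tauGr k)) := by
    intro z hz
    rw [eps_map, Finset.sum_eq_single k]
    · intro j _ hj
      rcases hj.lt_or_gt with hjk | hjk
      · rw [(hg j).2 z ((hmono hjk).trans_le hz), mul_zero]
      · rw [h.2 j hjk, zero_mul]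
    · simp
  refine ⟨?_, fun z hz => ?_⟩
  · rw [hsum _ le_rfl]
    exact mul_ne_zero h.1 (hg k).1
  · rw [hsum z hz.le, (hg k).2 z hz, mul_zero]

theorem isLevel_tau (k : ι) : IsLevel (tauGr k) k :=
  ⟨by rw [eps_tau_self]; exact one_ne_zero, fun _ hj => eps_tau_of_ne hj.ne'⟩

end Wreath

/-! ### Homeomorphisms with nested fundamental domains -/

/-- The two endpoints of a fundamental domain of each of finitely many homeomorphisms, such that
each fundamental domain contains the supports of the homeomorphisms of smaller index. -/
structure NestedDomains {ι : Type*} [LinearOrder ι] (g : ι → HomeoPlus) (l r : ι → I) :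
    Prop where
  lt : ∀ c, l c < r c
  map_left : ∀ c, g c (l c) = r c
  fixed : ∀ c d, c < d → ∀ t, t ∉ Set.Ico (l d) (r d) → g c t = t
  exists_zpow_mem : ∀ c t, g c t ≠ t → ∃ n : ℤ, (g c ^ n) t ∈ Set.Ico (l c) (r c)

theorem strictMono_zpow_apply {g : HomeoPlus} {t : I} (h : t < g t) :
    StrictMono fun n : ℤ => (g ^ n) t := by
  refine strictMono_int_of_lt_succ fun n => ?_
  rw [zpow_add_one]
  exact (g ^ n).strictMono h

theorem zpow_apply_mem_Ico {g : HomeoPlus} {l r t : I} (hlr : l < r) (hl : g l = r)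
    (ht : t ∈ Set.Ico l r) {n : ℤ} (hn : (g ^ n) t ∈ Set.Ico l r) : n = 0 := by
  have hmono : StrictMono fun n : ℤ => (g ^ n) l := strictMono_zpow_apply (by rwa [hl])
  have h1 : (g ^ (1 : ℤ)) l = r := by rw [zpow_one, hl]
  have h0 : (g ^ (0 : ℤ)) l = l := rfl
  rcases lt_trichotomy n 0 with h | h | h
  · have h2 : (g ^ n) t < (g ^ (n + 1)) l := by
      rw [zpow_add_one]
      change (g ^ n) t < (g ^ n) (g l)
      rw [hl]
      exact (g ^ n).strictMono ht.2
    have h3 := hmono.monotone (show n + 1 ≤ 0 by omega)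
    simp only [h0] at h3
    exact absurd hn.1 (not_le.mpr (h2.trans_le h3))
  · exact h
  · have h2 := (g ^ n).monotone ht.1
    have h3 := hmono.monotone (show 1 ≤ n by omega)
    simp only [h1] at h3
    exact absurd hn.2 (not_lt.mpr (h3.trans h2))

/-- A homeomorphism that moves every point between `p` and `q` has every such point in the orbit
of any of its fundamental domains. -/
theorem exists_zpow_apply_mem_Ico {g : HomeoPlus} {p q l r t : I} (hpl : p < l) (hlq : l < q)
    (hlr : l < r) (hl : g l = r) (hmoved : ∀ s, p < s → s < q → g s ≠ s) (hpt : p < t)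
    (htq : t < q) : ∃ n : ℤ, (g ^ n) t ∈ Set.Ico l r := by
  have hmono : StrictMono fun n : ℤ => (g ^ n) l := strictMono_zpow_apply (by rwa [hl])
  have hmap : ∀ n : ℤ, g ((g ^ n) l) = (g ^ (n + 1)) l := fun n => by
    rw [add_comm, zpow_one_add]; rfl
  have himage : g '' Set.range (fun n : ℤ => (g ^ n) l) = Set.range fun n : ℤ => (g ^ n) l := by
    ext s
    constructor
    · rintro ⟨_, ⟨n, rfl⟩, rfl⟩
      exact ⟨n + 1, (hmap n).symm⟩
    · rintro ⟨n, rfl⟩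
      exact ⟨_, ⟨n - 1, rfl⟩, by simp only [hmap, sub_add_cancel]⟩
  have hzero : l ∈ Set.range fun n : ℤ => (g ^ n) l := ⟨0, rfl⟩
  obtain ⟨n, hn⟩ : ∃ n : ℤ, t < (g ^ n) l := by
    -- The supremum of an orbit is a fixed point, so it cannot lie strictly between `p` and `q`; the
    -- infimum is treated likewise below.
    have hlub := isLUB_csSup ⟨l, hzero⟩
      (⟨⟨1, by simp⟩, fun s _ => s.2.2⟩ : BddAbove (Set.range fun n : ℤ => (g ^ n) l))
    have hfix := (g.isLUB_image'.mpr hlub)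
    rw [himage] at hfix
    obtain ⟨_, ⟨n, rfl⟩, hn, -⟩ := hlub.exists_between (b := t) (by
      by_contra hc
      exact hmoved _ (hpl.trans_le (hlub.1 hzero)) ((not_lt.mp hc).trans_lt htq)
        (hfix.unique hlub))
    exact ⟨n, hn⟩
  obtain ⟨m, hm⟩ : ∃ m : ℤ, (g ^ m) l < t := by
    have hglb := isGLB_csInf ⟨l, hzero⟩
      (⟨⟨0, by simp⟩, fun s _ => s.2.1⟩ : BddBelow (Set.range fun n : ℤ => (g ^ n) l))
    have hfix := (g.isGLB_image'.mpr hglb)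
    rw [himage] at hfix
    obtain ⟨_, ⟨n, rfl⟩, -, hn⟩ := hglb.exists_between (b := t) (by
      by_contra hc
      exact hmoved _ (hpt.trans_le (not_lt.mp hc)) ((hglb.1 hzero).trans_lt hlq)
        (hfix.unique hglb))
    exact ⟨n, hn⟩
  obtain ⟨k, hk, hkmax⟩ := Int.exists_greatest_of_bdd (P := fun k => (g ^ k) l ≤ t)
    ⟨n, fun z hz => (hmono.lt_iff_lt.mp (hz.trans_lt hn)).le⟩ ⟨m, hm.le⟩
  have hk' : t < (g ^ (k + 1)) l := by
    by_contra hc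
    have := hkmax _ (not_lt.mp hc)
    omega
  have hinv : ∀ s, (g ^ (-k)) ((g ^ k) s) = s := fun s => by
    rw [← RelIso.mul_apply, ← zpow_add, neg_add_cancel]; rfl
  refine ⟨-k, ?_, ?_⟩
  · simpa only [hinv] using (g ^ (-k)).monotone hk
  · have h1 := (g ^ (-k)).strictMono hk'
    rw [zpow_add_one, RelIso.mul_apply, hinv, hl] at h1
    exact h1

variable {ι : Type*} [LinearOrder ι]

open Classical in
/-- The action of a generator when only the coordinates in `F` are taken into account. -/
noncomputable def tauOn (F : Finset ι) (c : ι) (ω : ι → ℤ) : ι → ℤ :=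
  if ∀ d ∈ F, c < d → ω d = 0 then ω + Pi.single c 1 else ω

/-- Sequences serve as addresses of points in the orbit of `q`. With `m` the largest index, a moved
`q` is brought into the domain of `m` by a power of `g m`, and the new map is `g m ^ ω m` applied to
the map for the smaller indices. The clause on invariant sets keeps the latter inside the domain of
`m`; the last clause is injectivity on the relevant coordinates. -/
theorem exists_equivariant {g : ι → HomeoPlus} {l r : ι → I} (h : NestedDomains g l r)
    (F : Finset ι) : ∀ q : I, ∃ f : (ι → ℤ) → I,
      (∀ ω ω', (∀ c ∈ F, ω c = ω' c) → f ω = f ω') ∧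
      (∀ c ∈ F, ∀ ω, f (tauOn F c ω) = g c (f ω)) ∧
      (∃ ω, f ω = q) ∧
      (∀ S : Set I, (∀ c ∈ F, ∀ t, g c t ∈ S ↔ t ∈ S) → q ∈ S → ∀ ω, f ω ∈ S) ∧
      ((∀ c ∈ F, q ∈ Set.Ico (l c) (r c)) → ∀ ω ω', f ω = f ω' → ∀ c ∈ F, ω c = ω' c) := by
  classical
  induction F using Finset.induction_on_max with
  | empty => exact fun q => ⟨fun _ => q, by simp⟩
  | insert m F hF ih =>
    intro q
    -- A point fixed by `g m` lies outside its fundamental domain, so all smaller generators fix it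
    -- too and a constant map suffices.
    by_cases hq : g m q = q
    · have hqm : q ∉ Set.Ico (l m) (r m) := by
        intro hq'
        have h1 := (g m).monotone hq'.1
        rw [h.map_left, hq] at h1
        exact absurd hq'.2 (not_lt.mpr h1)
      refine ⟨fun _ => q, fun _ _ _ => rfl, fun c hc ω => ?_, ⟨0, rfl⟩, fun S _ hS _ => hS,
        fun hall => absurd (hall m (Finset.mem_insert_self m F)) hqm⟩
      rcases Finset.mem_insert.mp hc with rfl | hc
      · exact hq.symm
      · exact (h.fixed c m (hF c hc) q hqm).symm
    · obtain ⟨n, hn⟩ := h.exists_zpow_mem m q hq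
      obtain ⟨f, f1, f2, ⟨ω₀, f3⟩, f4, f5⟩ := ih ((g m ^ n) q)
      have hdom : ∀ ω, f ω ∈ Set.Ico (l m) (r m) := by
        refine f4 _ (fun c hc t => ⟨fun ht => ?_, fun ht => ?_⟩) hn
        · by_contra hc'
          rw [h.fixed c m (hF c hc) t hc'] at ht
          exact hc' ht
        · by_contra hc'
          have := (g c).injective (h.fixed c m (hF c hc) _ hc')
          rw [this] at hc'
          exact hc' ht
      refine ⟨fun ω => (g m ^ ω m) (f ω), fun ω ω' hω => ?_, fun c hc ω => ?_, ?_, ?_, ?_⟩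
      · dsimp only
        rw [hω m (Finset.mem_insert_self m F),
          f1 ω ω' fun c hc => hω c (Finset.mem_insert_of_mem hc)]
      · dsimp only
        rcases Finset.mem_insert.mp hc with rfl | hc
        · have h1 : tauOn (insert c F) c ω = ω + Pi.single c 1 := by
            refine if_pos fun d hd hcd => ?_
            rcases Finset.mem_insert.mp hd with rfl | hd
            · exact absurd hcd (lt_irrefl _)
            · exact absurd hcd (hF d hd).not_gt
          rw [h1, f1 (ω + Pi.single c 1) ω fun d hd => by simp [(hF d hd).ne]]
          simp only [Pi.add_apply, Pi.single_eq_same]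
          rw [add_comm, zpow_one_add]
          rfl
        · have hcm : m ≠ c := (hF c hc).ne'
          by_cases h0 : ω m = 0
          · have h1 : tauOn (insert m F) c ω = tauOn F c ω := by
              unfold tauOn
              congr 1
              simp [h0]
            have h2 : tauOn F c ω m = 0 := by
              unfold tauOn
              split_ifs <;> simp [h0, hcm]
            rw [h1, h2, h0, zpow_zero]
            exact f2 c hc ω
          · have h1 : tauOn (insert m F) c ω = ω :=
              if_neg fun hall => h0 (hall m (Finset.mem_insert_self m F) (hF c hc))
            rw [h1, h.fixed c m (hF c hc)]
            exact fun hmem => h0 (zpow_apply_mem_Ico (h.lt m) (h.map_left m) (hdom ω) hmem)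
      · refine ⟨Function.update ω₀ m (-n), ?_⟩
        dsimp only
        rw [f1 _ ω₀ fun c hc => by simp [(hF c hc).ne], f3, Function.update_self, ← RelIso.mul_apply, ← zpow_add, neg_add_cancel]
        rfl
      · intro S hS hqS ω
        have hz : ∀ (k : ℤ) (t : I), (g m ^ k) t ∈ S ↔ t ∈ S := by
          intro k
          induction k using Int.induction_on with
          | zero => exact fun t => Iff.rfl
          | succ k ihk =>
              intro t
              rw [zpow_add_one, RelIso.mul_apply, ihk, hS m (Finset.mem_insert_self m F)]
          | pred k ihk =>
              intro t
              rw [zpow_sub_one, RelIso.mul_apply, ihk, ← hS m (Finset.mem_insert_self m F),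
                RelIso.apply_inv_self]
        exact (hz _ _).mpr (f4 S (fun c hc => hS c (Finset.mem_insert_of_mem hc))
          ((hz _ _).mpr hqS) ω)
      · intro hall ω ω' hωω'
        dsimp only at hωω'
        have hn0 := zpow_apply_mem_Ico (h.lt m) (h.map_left m)
          (hall m (Finset.mem_insert_self m F)) hn
        have hm : ω m = ω' m := by
          have h1 : (g m ^ (-ω' m + ω m)) (f ω) = f ω' := by
            rw [zpow_add, RelIso.mul_apply, hωω', ← RelIso.mul_apply, ← zpow_add,
              neg_add_cancel]
            rfl
          have := zpow_apply_mem_Ico (h.lt m) (h.map_left m) (hdom ω) (h1 ▸ hdom ω')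
          omega
        intro c hc
        rcases Finset.mem_insert.mp hc with rfl | hc
        · exact hm
        · rw [hm] at hωω'
          refine f5 (fun c hc => ?_) ω ω' ((g m ^ ω' m).injective hωω') c hc
          rw [hn0, zpow_zero]
          exact hall c (Finset.mem_insert_of_mem hc)

/-- Words are trivial as homeomorphisms if and only if they are trivial in the iterated wreath
product. -/
theorem lift_eq_one_iff [Finite ι] {g : ι → HomeoPlus} {l r : ι → I} (h : NestedDomains g l r)
    {p : I} (hp : ∀ c, p ∈ Set.Ico (l c) (r c)) (w : FreeGroup ι) :
    FreeGroup.lift g w = 1 ↔ FreeGroup.lift (Wreath.tau (ι := ι)) w = 1 := by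
  have := Fintype.ofFinite ι
  have htau : ∀ (c : ι) (ω : ι → ℤ), tauOn Finset.univ c ω = Wreath.tau c ω := by
    intro c ω
    rw [Wreath.tau_apply]
    unfold tauOn Wreath.tauFun Wreath.Agree
    congr 1
    simp
  have hequi : ∀ f : (ι → ℤ) → I, (∀ c ω, f (Wreath.tau c ω) = g c (f ω)) →
      ∀ (w : FreeGroup ι) ω, f (FreeGroup.lift Wreath.tau w ω) = FreeGroup.lift g w (f ω) := by
    intro f hf w
    induction w using FreeGroup.induction_on with
    | C1 => exact fun ω => by simp
    | of c => exact fun ω => by simpa using hf c ω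
    | inv_of c _ =>
      intro ω
      rw [map_inv, map_inv, FreeGroup.lift_apply_of, FreeGroup.lift_apply_of]
      apply (g c).injective
      rw [← hf, RelIso.apply_inv_self, Wreath.apply_inv_self']
    | mul x y hx hy =>
        intro ω
        rw [map_mul, map_mul, RelIso.mul_apply, Equiv.Perm.mul_apply, hx, hy]
  -- Forward, a map that is injective because `p` lies in all the domains carries triviality to
  -- sequences; backward, every point is a value of some equivariant map.
  constructor
  · intro hw
    obtain ⟨f, -, f2, -, -, f5⟩ := exists_equivariant h Finset.univ p
    refine Equiv.ext fun ω => funext fun c => ?_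
    refine f5 (fun c _ => hp c) _ _ ?_ c (Finset.mem_univ c)
    rw [hequi f (fun c ω => by rw [← htau]; exact f2 c (Finset.mem_univ c) ω), hw]
    rfl
  · intro hw
    refine RelIso.ext fun q => ?_
    obtain ⟨f, -, f2, ⟨ω, rfl⟩, -, -⟩ := exists_equivariant h Finset.univ q
    rw [← hequi f (fun c ω => by rw [← htau]; exact f2 c (Finset.mem_univ c) ω), hw]
    rfl

/-! ### Cantor intervals and the identification of the generated groups -/

/-- The remaining intervals, generated by self-similarity. -/
inductive IsSelfSimilar : ℝ → ℝ → Prop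
  | unit : IsSelfSimilar 0 1
  | low {a b : ℝ} (h : IsSelfSimilar a b) : IsSelfSimilar (a / 4) (b / 4)
  | high {a b : ℝ} (h : IsSelfSimilar a b) : IsSelfSimilar ((a + 3) / 4) ((b + 3) / 4)

theorem IsSelfSimilar.bounds {a b : ℝ} (h : IsSelfSimilar a b) : 0 ≤ a ∧ a < b ∧ b ≤ 1 := by
  induction h with
  | unit => norm_num
  | low _ ih => refine ⟨?_, ?_, ?_⟩ <;> linarith [ih.1, ih.2.1, ih.2.2]
  | high _ ih => refine ⟨?_, ?_, ?_⟩ <;> linarith [ih.1, ih.2.1, ih.2.2]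

theorem IsSelfSimilar.left {a b : ℝ} (h : IsSelfSimilar a b) :
    IsSelfSimilar a (a + (b - a) / 4) := by
  induction h with
  | unit => convert IsSelfSimilar.unit.low using 1 <;> norm_num
  | low _ ih => convert ih.low using 1; ring
  | high _ ih => convert ih.high using 1; ring

theorem IsSelfSimilar.right {a b : ℝ} (h : IsSelfSimilar a b) :
    IsSelfSimilar (b - (b - a) / 4) b := by
  induction h with
  | unit => convert IsSelfSimilar.unit.high using 1 <;> norm_num
  | low _ ih => convert ih.low using 1; ring
  | high _ ih => convert ih.high using 1; ring

theorem IsRemaining.isSelfSimilar {a b : ℝ} (h : IsRemaining a b) : IsSelfSimilar a b := by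
  induction h with
  | unit => exact .unit
  | left _ ih => exact ih.left
  | right _ ih => exact ih.right

/-- Building intervals by the outermost step first allows a simultaneous induction: two intervals in
the same outer quarter are compared after rescaling, and the other cases follow from their bounds.
-/
theorem IsSelfSimilar.disjoint {a b a' b' : ℝ} (h : IsSelfSimilar a b)
    (h' : IsSelfSimilar a' b') : (a = a' ∧ b = b') ∨
      b - (b - a) / 4 ≤ a' + (b' - a') / 4 ∨ b' - (b' - a') / 4 ≤ a + (b - a) / 4 := by
  induction h generalizing a' b' with
  | unit =>
    cases h' with
    | unit => exact Or.inl ⟨rfl, rfl⟩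
    | low h' => exact Or.inr (Or.inr (by linarith [h'.bounds.1, h'.bounds.2.1, h'.bounds.2.2]))
    | high h' => exact Or.inr (Or.inl (by linarith [h'.bounds.1, h'.bounds.2.1, h'.bounds.2.2]))
  | low h ih =>
    obtain ⟨h0, h1, h2⟩ := h.bounds
    cases h' with
    | unit => exact Or.inr (Or.inl (by linarith))
    | low h' =>
      rcases ih h' with ⟨e1, e2⟩ | h3 | h3
      · exact Or.inl ⟨by rw [e1], by rw [e2]⟩
      · exact Or.inr (Or.inl (by linarith))
      · exact Or.inr (Or.inr (by linarith))
    | high h' => exact Or.inr (Or.inl (by linarith [h'.bounds.1, h'.bounds.2.1, h'.bounds.2.2]))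
  | high h ih =>
    obtain ⟨h0, h1, h2⟩ := h.bounds
    cases h' with
    | unit => exact Or.inr (Or.inr (by linarith))
    | low h' => exact Or.inr (Or.inr (by linarith [h'.bounds.1, h'.bounds.2.1, h'.bounds.2.2]))
    | high h' =>
      rcases ih h' with ⟨e1, e2⟩ | h3 | h3
      · exact Or.inl ⟨by rw [e1], by rw [e2]⟩
      · exact Or.inr (Or.inl (by linarith))
      · exact Or.inr (Or.inr (by linarith))

theorem IsDeleted.lt {l r : ℝ} (h : IsDeleted l r) : l < r := by
  obtain ⟨a, b, h, rfl, rfl⟩ := h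
  linarith [h.isSelfSimilar.bounds.2.1]

/-- Deleted intervals are disjoint, hence ordered as their midpoints are. -/
theorem IsDeleted.le_of_midpoint_lt {l r l' r' : ℝ} (h : IsDeleted l r) (h' : IsDeleted l' r')
    (hlt : (l + r) / 2 < (l' + r') / 2) : r ≤ l' := by
  have h1 := h.lt
  have h1' := h'.lt
  obtain ⟨a, b, h, rfl, rfl⟩ := h
  obtain ⟨a', b', h', rfl, rfl⟩ := h'
  rcases h.isSelfSimilar.disjoint h'.isSelfSimilar with ⟨rfl, rfl⟩ | h2 | h2
  · exact absurd hlt (lt_irrefl _)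
  · exact h2
  · linarith

namespace WData

variable {C : Type*} [LinearOrder C] (W : WData C)

theorem lo_mem (c : C) : W.lo c ∈ Set.Icc (0 : ℝ) 1 := by
  have := W.confined c
  have := (W.deleted c).lt
  constructor <;> linarith

theorem one_sub_lo_mem (c : C) : 1 - W.lo c ∈ Set.Icc (0 : ℝ) 1 := by
  have := W.lo_mem c
  constructor <;> linarith [this.1, this.2]

/-- For `c < d` disjointness gives `hi c ≤ lo d`; the midpoint of the interval of `c` is thus below
`lo d`, and the orbital of `gen c` lies in the domain of `gen d`. -/
theorem nestedDomains (X : Finset C) :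
    NestedDomains (fun x : X => W.gen x) (fun x => ⟨1 - W.lo x, W.one_sub_lo_mem x⟩)
      (fun x => ⟨W.lo x, W.lo_mem x⟩) where
  lt c := by
    have := W.confined (c : C)
    exact Subtype.mk_lt_mk.mpr (by linarith)
  map_left c := Subtype.ext (W.gen_lo c _ rfl)
  fixed c d hcd t ht := by
    have h1 := (W.deleted c).le_of_midpoint_lt (W.deleted d)
      (W.strictMono_midpoint (show (c : C) < d from hcd))
    have h2 := (W.deleted c).lt
    refine W.gen_fixed c t ?_
    by_contra! hc
    refine ht ⟨?_, ?_⟩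
    · exact Subtype.coe_le_coe.mp (show 1 - W.lo d ≤ (t : ℝ) by linarith)
    · exact Subtype.coe_lt_coe.mp (show (t : ℝ) < W.lo d by linarith)
  exists_zpow_mem c t ht := by
    have h1 := W.confined (c : C)
    have h2 := (W.deleted c).lt
    have h3 : 1 - (W.lo c + W.hi c) / 2 < (t : ℝ) ∧ (t : ℝ) < (W.lo c + W.hi c) / 2 := by
      by_contra hc
      refine ht (W.gen_fixed c t ?_)
      by_contra! hc'
      exact hc hc'
    have hq : (W.lo c + W.hi c) / 2 ∈ Set.Icc (0 : ℝ) 1 := by constructor <;> linarith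
    have hp : 1 - (W.lo c + W.hi c) / 2 ∈ Set.Icc (0 : ℝ) 1 := by constructor <;> linarith
    refine exists_zpow_apply_mem_Ico (p := ⟨_, hp⟩) (q := ⟨_, hq⟩) ?_ ?_ ?_ ?_ ?_ ?_ ?_
    · exact Subtype.mk_lt_mk.mpr (by linarith)
    · exact Subtype.mk_lt_mk.mpr (by linarith)
    · exact Subtype.mk_lt_mk.mpr (by linarith)
    · exact Subtype.ext (W.gen_lo c _ rfl)
    · exact fun s hs hs' => W.gen_moved c s hs hs'
    · exact h3.1
    · exact h3.2

theorem coe_eval (X : Finset C) (w : FreeGroup X) :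
    (W.eval X w : HomeoPlus) = FreeGroup.lift (fun x : X => W.gen x) w := by
  have : (W.group X).subtype.comp (W.eval X) = FreeGroup.lift (fun x : X => W.gen x) :=
    FreeGroup.ext_hom _ _ fun x => by simp [eval, genIn]
  exact DFunLike.congr_fun this w

theorem eval_surjective (X : Finset C) : Function.Surjective (W.eval X) := by
  rintro ⟨g, hg⟩
  induction hg using Subgroup.closure_induction with
  | mem g hg =>
    obtain ⟨x, hx, rfl⟩ := hg
    exact ⟨FreeGroup.of ⟨x, hx⟩, by simp [eval, genIn]⟩
  | one => exact ⟨1, map_one _⟩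
  | mul a b ha hb iha ihb =>
    obtain ⟨v, hv⟩ := iha
    obtain ⟨w, hw⟩ := ihb
    exact ⟨v * w, by rw [map_mul, hv, hw]; rfl⟩
  | inv a ha ih =>
    obtain ⟨v, hv⟩ := ih
    exact ⟨v⁻¹, by rw [map_inv, hv]; rfl⟩

end WData

namespace Wreath

variable {ι : Type*} [LinearOrder ι]

theorem coe_lift_tauGr (w : FreeGroup ι) :
    (FreeGroup.lift (tauGr (ι := ι)) w : Equiv.Perm (ι → ℤ)) = FreeGroup.lift tau w := by
  have : (Gr ι).subtype.comp (FreeGroup.lift (tauGr (ι := ι))) = FreeGroup.lift tau :=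
    FreeGroup.ext_hom _ _ fun x => by simp [tauGr]
  exact DFunLike.congr_fun this w

theorem lift_tauGr_surjective : Function.Surjective (FreeGroup.lift (tauGr (ι := ι))) := by
  intro a
  induction a using Gr_hom_induction with
  | gen c => exact ⟨FreeGroup.of c, by simp⟩
  | one => exact ⟨1, map_one _⟩
  | mul a b iha ihb =>
    obtain ⟨v, rfl⟩ := iha
    obtain ⟨w, rfl⟩ := ihb
    exact ⟨v * w, map_mul _ _ _⟩
  | inv a ih =>
    obtain ⟨v, rfl⟩ := ih
    exact ⟨v⁻¹, map_inv _ _⟩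

theorem expSum_eq_eps [inst : DecidableEq ι] (x : ι) (w : FreeGroup ι) :
    expSum x w = eps x (FreeGroup.lift tauGr w) := by
  unfold expSum
  induction w using FreeGroup.induction_on with
  | C1 => simp [eps_one]
  | of c =>
    rcases eq_or_ne c x with rfl | h
    · simp [eps_tau_self]
    · simp [eps_tau_of_ne h.symm, h]
  | inv_of c ih => simp only [map_inv, toAdd_inv, ih, eps_inv]
  | mul v w hv hw => simp only [map_mul, toAdd_mul, hv, hw, eps_mul]

end Wreath

namespace WData

open Wreath

variable {C : Type*} [LinearOrder C] (W : WData C)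

/-- The group generated by the generators attached to a finite set is the iterated wreath
product. -/
theorem exists_mulEquiv (X : Finset C) : ∃ e : W.group X ≃* Gr X,
    ∀ w, e (W.eval X w) = FreeGroup.lift tauGr w := by
  -- Both groups are quotients of the same free group. The point `1 / 2` lies in every fundamental
  -- domain because `lo c ≥ 3 / 4`.
  have hker : (W.eval X).ker = (FreeGroup.lift (tauGr (ι := X))).ker := by
    ext w
    rw [MonoidHom.mem_ker, MonoidHom.mem_ker, ← Subtype.coe_inj, W.coe_eval, ← Subtype.coe_inj,
      coe_lift_tauGr]
    refine lift_eq_one_iff (W.nestedDomains X) (p := ⟨1 / 2, by norm_num⟩) (fun c => ?_) w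
    have := W.confined (c : C)
    constructor
    · exact Subtype.mk_le_mk.mpr (by linarith)
    · exact Subtype.mk_lt_mk.mpr (by linarith)
  refine ⟨(QuotientGroup.quotientKerEquivOfSurjective _ (W.eval_surjective X)).symm.trans
    ((QuotientGroup.quotientMulEquivOfEq hker).trans
      (QuotientGroup.quotientKerEquivOfSurjective _ lift_tauGr_surjective)), fun w => ?_⟩
  have h : (QuotientGroup.quotientKerEquivOfSurjective _ (W.eval_surjective X)).symm
      (W.eval X w) = (w : FreeGroup X ⧸ (W.eval X).ker) := by
    rw [MulEquiv.symm_apply_eq]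
    rfl
  rw [MulEquiv.trans_apply, h]
  rfl

/-- The identification of the group generated by the generators attached to a finite set with
the iterated wreath product. -/
noncomputable def toGr (X : Finset C) : W.group X ≃* Gr X := (W.exists_mulEquiv X).choose

theorem toGr_eval (X : Finset C) (w : FreeGroup X) :
    W.toGr X (W.eval X w) = FreeGroup.lift tauGr w := (W.exists_mulEquiv X).choose_spec w

theorem toGr_genIn (X : Finset C) (x : X) : W.toGr X (W.genIn X x) = tauGr x := by
  have := W.toGr_eval X (FreeGroup.of x)
  simpa [eval] using this

theorem toGr_symm_tauGr (X : Finset C) (x : X) : (W.toGr X).symm (tauGr x) = W.genIn X x := by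
  rw [MulEquiv.symm_apply_eq, toGr_genIn]

theorem hasLevel_of_isLevel {X : Finset C} {g : W.group X} {k : X}
    (h : IsLevel (W.toGr X g) k) : W.HasLevel X g (slot X k) := by
  rintro w rfl
  rw [toGr_eval] at h
  unfold wordLevel
  refine le_antisymm (Finset.sup_le fun x hx => ?_) (Finset.le_sup (f := slot X) ?_)
  · have hx' : eps x (FreeGroup.lift tauGr w) ≠ 0 := by
      rw [← expSum_eq_eps]
      simpa using hx
    have hxk : x ≤ k := by
      by_contra hc
      exact hx' (h.2 x (not_le.mp hc))
    refine Finset.card_le_card fun y hy => ?_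
    rw [Finset.mem_filter] at hy ⊢
    exact ⟨hy.1, hy.2.trans hxk⟩
  · rw [Finset.mem_filter, expSum_eq_eps]
    exact ⟨Finset.mem_univ k, h.1⟩

end WData

/-! ### Passage to the direct systems -/

open Wreath in
/-- An inj-isomorphism of direct systems of groups induces one of the direct systems of ordered
sets, through the levels of the images of the generators. -/
theorem GroupInjIso.exists_setInjIso {C D : Type*} [LinearOrder C] [LinearOrder D]
    (V : WData C) (W : WData D)
    (X : Exhaustion C) (Y : Exhaustion D)
    (P : GroupInjIso V W X Y) :
    ∃ P' : SetInjIso X Y,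
      (∀ (i : ℕ) (x : X.set i),
        W.HasLevel (Y.set i) (P.d i (V.genIn (X.set i) x))
          (slot (Y.set i) (P'.d i x))) ∧
      (∀ (i : ℕ) (y : Y.set i),
        V.HasLevel (X.set (i + 1)) (P.u i (W.genIn (Y.set i) y))
          (slot (X.set (i + 1)) (P'.u i y))) := by
  have hd : ∀ i, Function.Injective (P.d i) := fun i a b h => by
    have := congrArg (P.u i) h
    rw [P.u_d, P.u_d] at this
    exact Subgroup.inclusion_injective _ this
  have hu : ∀ i, Function.Injective (P.u i) := fun i a b h => by
    have := congrArg (P.d (i + 1)) h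
    rw [P.d_u, P.d_u] at this
    exact Subgroup.inclusion_injective _ this
  let f : ∀ i, Gr (X.set i) →* Gr (Y.set i) := fun i =>
    (W.toGr (Y.set i)).toMonoidHom.comp ((P.d i).comp (V.toGr (X.set i)).symm.toMonoidHom)
  let g : ∀ i, Gr (Y.set i) →* Gr (X.set (i + 1)) := fun i =>
    (V.toGr (X.set (i + 1))).toMonoidHom.comp ((P.u i).comp (W.toGr (Y.set i)).symm.toMonoidHom)
  have hf : ∀ i a, f i a = W.toGr _ (P.d i ((V.toGr _).symm a)) := fun _ _ => rfl
  have hg : ∀ i a, g i a = V.toGr _ (P.u i ((W.toGr _).symm a)) := fun _ _ => rfl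
  have hfinj : ∀ i, Function.Injective (f i) := fun i =>
    (W.toGr _).injective.comp ((hd i).comp (V.toGr _).symm.injective)
  have hginj : ∀ i, Function.Injective (g i) := fun i =>
    (V.toGr _).injective.comp ((hu i).comp (W.toGr _).symm.injective)
  have hgf : ∀ i (x : X.set i), g i (f i (tauGr x)) = tauGr ⟨x, X.mono i x.2⟩ := by
    intro i x
    rw [hf, hg, MulEquiv.symm_apply_apply, P.u_d, V.toGr_symm_tauGr, ← V.toGr_genIn]
    rfl
  have hfg : ∀ i (y : Y.set i), f (i + 1) (g i (tauGr y)) = tauGr ⟨y, Y.mono i y.2⟩ := by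
    intro i y
    rw [hg, hf, MulEquiv.symm_apply_apply, P.d_u, W.toGr_symm_tauGr, ← W.toGr_genIn]
    rfl
  choose d' hd' hdl using fun i => exists_strictMono_level (hginj i)
    (inc := fun x : X.set i => ⟨x, X.mono i x.2⟩) (fun _ _ h => h) (hgf i)
  choose u' hu' hul using fun i => exists_strictMono_level (hfinj (i + 1))
    (inc := fun y : Y.set i => ⟨y, Y.mono i y.2⟩) (fun _ _ h => h) (hfg i)
  refine ⟨⟨fun i => OrderEmbedding.ofStrictMono _ (hd' i),
    fun i => OrderEmbedding.ofStrictMono _ (hu' i), fun i x => ?_, fun i y => ?_⟩,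
    fun i x => ?_, fun i y => ?_⟩
  -- The composite of the level maps computes the level of the composite, which sends a generator to
  -- the generator of the same element; uniqueness of levels closes the triangle.
  · have h := (hdl i x).map (hu' i) (hul i)
    rw [hgf] at h
    exact h.unique (isLevel_tau _)
  · have h := (hul i y).map (hd' (i + 1)) (hdl (i + 1))
    rw [hfg] at h
    exact h.unique (isLevel_tau _)
  · refine W.hasLevel_of_isLevel ?_
    have h := hdl i x
    rwa [hf, V.toGr_symm_tauGr] at h
  · refine V.hasLevel_of_isLevel ?_
    have h := hul i y
    rwa [hg, W.toGr_symm_tauGr] at h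

end LocSolv

theorem mainTheorem11 {C D : Type*} [LinearOrder C] [Countable C] [LinearOrder D] [Countable D]
    (V : LocSolv.WData C) (W : LocSolv.WData D)
    (X : LocSolv.Exhaustion C) (Y : LocSolv.Exhaustion D)
    (P : LocSolv.GroupInjIso V W X Y) :
    ∃ P' : LocSolv.SetInjIso X Y,
      (∀ (i : ℕ) (x : X.set i),
        W.HasLevel (Y.set i) (P.d i (V.genIn (X.set i) x))
          (LocSolv.slot (Y.set i) (P'.d i x))) ∧
      (∀ (i : ℕ) (y : Y.set i),
        V.HasLevel (X.set (i + 1)) (P.u i (W.genIn (Y.set i) y))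
          (LocSolv.slot (X.set (i + 1)) (P'.u i y))) :=
  P.exists_setInjIso
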